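/- A \emph{broadcast protocol} is a tuple $P=(Q,\Sigma,q_{in},T)$ where $Q$ is a finite set of states, $\Sigma$ a finite set of messages, $q_{in}\in Q$ an initial state and $T\subseteq Q\times(\{!!a\mid a\in\Sigma\}\cup\{?a\mid a\in\Sigma\})\times Q$ a set of transitions. For $n\ge 1$, an $n$-process configuration is a vector $C\in Q^n$; it is initial if $C(e)=q_{in}$ for all $e$. For a broadcast transition $t=(q,!!a,q')\in T$ and a process $e\in\{1,\dots,n\}$, write $C\xrightarrow{e,t}C'$ if $C,C'\in Q^n$, $C(e)=q$, $C'(e)=q'$ and, for every process $e'\neq e$, either $(C(e'),?a,C'(e'))\in T$, or there is no $p\in Q$ with $(C(e'),?a,p)\in T$ and $C'(e')=C(e')$. Write $C\to C'$ if $C\xrightarrow{e,t}C'$ for some $e$ and $t$, and let $\to^*$ be the reflexive and transitive closure of $\to$. An infinite execution is an infinite sequence $\rho_0\to\rho_1\to\cdots$ of configurations with $\rho_0$ initial. \textsc{Synchro} is the following decision problem: given a broadcast protocol $P$ and a state $q_f\in Q$, are there $n\ge 1$, an initial $n$-process configuration $C$ and a configuration $C'$ such that $C\to^* C'$ and $C'(e)=q_f$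 for every process $e$? \textsc{Repeated Coverability} is the following decision problem: given a broadcast protocol $P$ and a broadcast transition $t=(q,!!a,q')\in T$, are there $n\ge 1$, an infinite execution $\rho$ with $n$ processes and a process $e$ such that for every $i\in\mathbb{N}$ there is $j>i$ with $\rho_j\xrightarrow{e,t}\rho_{j+1}$? \textbf{Theorem.} \textsc{Synchro} and \textsc{Repeated Coverability} are both undecidable. -/

import Mathlib

namespace BroadcastNetwork

/-! ### Broadcast protocols and their semantics -/

/-- The operations over a message alphabet: broadcasting `!!a` and receiving `?a`. -/
inductive Op (Msg : Type*) where
  | broadcast (a : Msg) : Op Msg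
  | receive (a : Msg) : Op Msg
  deriving DecidableEq

/-- A (general) broadcast protocol with finite state set `Q` and finite message alphabet `Msg`. -/
structure Protocol (Q Msg : Type*) [Finite Q] [Finite Msg] where
  /-- The initial state. -/
  init : Q
  /-- The set of transitions. -/
  trans : Set (Q × Op Msg × Q)

/-- Configurations with `n` processes (vectors in `Q ^ n`). -/
abbrev Config (Q : Type*) (n : ℕ) := Fin n → Q

namespace Protocol

variable {Q Msg : Type*} [Finite Q] [Finite Msg] (P : Protocol Q Msg)

/-- `P.receivable q` is the set of messages that can be received from the state `q`. -/
def receivable (q : Q) : Set Msg := {a | ∃ q', (q, Op.receive a, q') ∈ P.trans}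

/-- A configuration is initial when all its processes are in the initial state. -/
def IsInitial {n : ℕ} (C : Config Q n) : Prop := ∀ e, C e = P.init

/-- `P.StepBy e q a q' C C'`: process `e` takes the broadcast transition `(q, !!a, q')` of `P`, every
other process that can receive `a` takes some reception transition for `a`, and the remaining
processes stay where they are. -/
def StepBy {n : ℕ} (e : Fin n) (q : Q) (a : Msg) (q' : Q) (C C' : Config Q n) : Prop :=
  (q, Op.broadcast a, q') ∈ P.trans ∧ C e = q ∧ C' e = q' ∧
    ∀ e', e' ≠ e →
      (C e', Op.receive a, C' e') ∈ P.trans ∨ (a ∉ P.receivable (C e') ∧ C e' = C' e')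

/-- One step of the broadcast network. -/
def Step {n : ℕ} (C C' : Config Q n) : Prop := ∃ e q a q', P.StepBy e q a q' C C'

/-- Infinite executions with `n` processes. -/
def IsInfiniteExecution {n : ℕ} (ρ : ℕ → Config Q n) : Prop :=
  P.IsInitial (ρ 0) ∧ ∀ i, P.Step (ρ i) (ρ (i + 1))

/-- For some positive number of processes, some configuration with all processes in `qf` is
reachable from an initial configuration. -/
def Synchronizes (qf : Q) : Prop :=
  ∃ n : ℕ, 0 < n ∧ ∃ C C' : Config Q n,
    P.IsInitial C ∧ Relation.ReflTransGen P.Step C C' ∧ ∀ e, C' e = qf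

/-- For some positive number of processes, there is an infinite execution in which one and the same
process takes the broadcast transition `(q, !!a, q')` infinitely often. -/
def RepeatedlyCovers (q : Q) (a : Msg) (q' : Q) : Prop :=
  ∃ n : ℕ, 0 < n ∧ ∃ ρ : ℕ → Config Q n, P.IsInfiniteExecution ρ ∧
    ∃ e : Fin n, ∀ i, ∃ j, i < j ∧ P.StepBy e q a q' (ρ j) (ρ (j + 1))

end Protocol

/-! ### Protocols as finite inputs of decision problems

A protocol with `n` states and `m` messages is presented with states `0, …, n - 1`, messages
`0, …, m - 1`, an initial state, and the list of its transitions. -/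

/-- Operations are encoded like the disjoint union of two copies of the alphabet. -/
def Op.equivSum (Msg : Type*) : Op Msg ≃ Msg ⊕ Msg where
  toFun
    | .broadcast a => .inl a
    | .receive a => .inr a
  invFun
    | .inl a => .broadcast a
    | .inr a => .receive a
  left_inv := by rintro (_ | _) <;> rfl
  right_inv := by rintro (_ | _) <;> rfl

instance Op.instPrimcodable (Msg : Type*) [Primcodable Msg] : Primcodable (Op Msg) :=
  Primcodable.ofEquiv (Msg ⊕ Msg) (Op.equivSum Msg)

/-- The message of an operation. -/
def Op.msg {Msg : Type*} : Op Msg → Msg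
  | .broadcast a => a
  | .receive a => a

/-- Renaming of messages in an operation. -/
def Op.map {Msg Msg' : Type*} (f : Msg → Msg') : Op Msg → Op Msg'
  | .broadcast a => .broadcast (f a)
  | .receive a => .receive (f a)

theorem Op.primrec_msg {Msg : Type*} [Primcodable Msg] : Primrec (Op.msg : Op Msg → Msg) := by
  have h : Primrec (Op.equivSum Msg) := Primrec.of_equiv
  refine (Primrec.sumCasesOn h (g := fun _ a => a) (h := fun _ a => a)
    Primrec₂.right Primrec₂.right).of_eq ?_
  rintro (_ | _) <;> rfl

/-- Raw data `((n, m, init), transitions)`. -/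
abbrev RawCode := (ℕ × ℕ × ℕ) × List (ℕ × Op ℕ × ℕ)

/-- The initial state and all states and messages in the transitions are in range. -/
def RawCode.Valid (c : RawCode) : Prop :=
  c.1.2.2 < c.1.1 ∧ ∀ t ∈ c.2, t.1 < c.1.1 ∧ t.2.1.msg < c.1.2.1 ∧ t.2.2 < c.1.1

instance RawCode.instDecidablePredValid : DecidablePred RawCode.Valid := fun c => by
  unfold RawCode.Valid; infer_instance

theorem RawCode.primrecPred_valid : PrimrecPred RawCode.Valid := by
  have hR : PrimrecRel fun (t : ℕ × Op ℕ × ℕ) (c : ℕ × ℕ × ℕ) =>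
      t.1 < c.1 ∧ t.2.1.msg < c.2.1 ∧ t.2.2 < c.1 := by
    have hn : Primrec fun p : (ℕ × Op ℕ × ℕ) × (ℕ × ℕ × ℕ) => p.2.1 :=
      Primrec.fst.comp Primrec.snd
    have hm : Primrec fun p : (ℕ × Op ℕ × ℕ) × (ℕ × ℕ × ℕ) => p.2.2.1 :=
      Primrec.fst.comp (Primrec.snd.comp Primrec.snd)
    have h1 : Primrec fun p : (ℕ × Op ℕ × ℕ) × (ℕ × ℕ × ℕ) => p.1.1 :=
      Primrec.fst.comp Primrec.fst
    have h2 : Primrec fun p : (ℕ × Op ℕ × ℕ) × (ℕ × ℕ × ℕ) => p.1.2.1.msg :=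
      Op.primrec_msg.comp (Primrec.fst.comp (Primrec.snd.comp Primrec.fst))
    have h3 : Primrec fun p : (ℕ × Op ℕ × ℕ) × (ℕ × ℕ × ℕ) => p.1.2.2 :=
      Primrec.snd.comp (Primrec.snd.comp Primrec.fst)
    exact (Primrec.nat_lt.comp h1 hn).and ((Primrec.nat_lt.comp h2 hm).and
      (Primrec.nat_lt.comp h3 hn))
  have hinit : PrimrecPred fun c : RawCode => c.1.2.2 < c.1.1 :=
    Primrec.nat_lt.comp (Primrec.snd.comp (Primrec.snd.comp Primrec.fst))
      (Primrec.fst.comp Primrec.fst)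
  exact hinit.and (hR.forall_mem_list.comp Primrec.snd Primrec.fst)

/-- Finite presentations of protocols. -/
abbrev ProtocolCode := {c : RawCode // c.Valid}

instance ProtocolCode.instPrimcodable : Primcodable ProtocolCode :=
  Primcodable.subtype RawCode.primrecPred_valid

namespace ProtocolCode

/-- The number of states. -/
def numStates (c : ProtocolCode) : ℕ := c.1.1.1

/-- The number of messages. -/
def numMsgs (c : ProtocolCode) : ℕ := c.1.1.2.1

/-- The list of transitions. -/
def transList (c : ProtocolCode) : List (ℕ × Op ℕ × ℕ) := c.1.2

/-- The protocol presented by `c`. -/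
def toProtocol (c : ProtocolCode) : Protocol (Fin c.numStates) (Fin c.numMsgs) where
  init := ⟨c.1.1.2.2, c.2.1⟩
  trans := {t | ((t.1 : ℕ), t.2.1.map Fin.val, (t.2.2 : ℕ)) ∈ c.transList}

end ProtocolCode

/-- The inputs of the synchronization problem: a protocol and one of its states. -/
abbrev SynchroInput := {x : ProtocolCode × ℕ // x.2 < x.1.numStates}

instance SynchroInput.instPrimcodable : Primcodable SynchroInput :=
  Primcodable.subtype (Primrec.nat_lt.comp Primrec.snd
    (Primrec.fst.comp (Primrec.fst.comp
      ((Primrec.subtype_val (hp := RawCode.primrecPred_valid)).comp Primrec.fst))))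

/-- The synchronization problem. -/
def Synchro (x : SynchroInput) : Prop := x.1.1.toProtocol.Synchronizes ⟨x.1.2, x.2⟩

/-- The inputs of the repeated coverability problem: a protocol and one of its broadcast
transitions `(q, !!a, q')`, given by the triple `(q, a, q')`. -/
abbrev RepeatedCoverabilityInput :=
  {x : ProtocolCode × (ℕ × ℕ × ℕ) // (x.2.1, Op.broadcast x.2.2.1, x.2.2.2) ∈ x.1.transList}

instance RepeatedCoverabilityInput.instPrimcodable : Primcodable RepeatedCoverabilityInput :=
  Primcodable.subtype (by
    have hb : Primrec fun a : ℕ => Op.broadcast a :=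
      (Primrec.of_equiv_symm (e := Op.equivSum ℕ)).comp Primrec.sumInl
    have ht : Primrec fun x : ProtocolCode × (ℕ × ℕ × ℕ) =>
        (x.2.1, Op.broadcast x.2.2.1, x.2.2.2) :=
      (Primrec.fst.comp Primrec.snd).pair
        ((hb.comp (Primrec.fst.comp (Primrec.snd.comp Primrec.snd))).pair
          (Primrec.snd.comp (Primrec.snd.comp Primrec.snd)))
    have hl : Primrec fun x : ProtocolCode × (ℕ × ℕ × ℕ) => x.1.transList :=
      Primrec.snd.comp ((Primrec.subtype_val (hp := RawCode.primrecPred_valid)).comp Primrec.fst)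
    exact ((Primrec.eq (α := ℕ × Op ℕ × ℕ)).exists_mem_list.comp hl ht).of_eq (by simp))

/-- The repeated coverability problem. -/
def RepeatedCoverability (x : RepeatedCoverabilityInput) : Prop :=
  x.1.1.toProtocol.RepeatedlyCovers
    ⟨x.1.2.1, (x.1.1.2.2 _ x.2).1⟩
    ⟨x.1.2.2.1, (x.1.1.2.2 _ x.2).2.1⟩
    ⟨x.1.2.2.2, (x.1.1.2.2 _ x.2).2.2⟩

end BroadcastNetwork

/-!
Both problems are undecidable because broadcast protocols can simulate counter machines, up to
errors that are detected afterwards.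

In the protocol `machineProtocol` of a counter machine, the first broadcast elects a leader, which
holds the control state, and sends all other processes to a pool. The value of a counter is the
number of processes in a state of its own. A process moves from the pool to a counter, or back, by
a broadcast that the leader receives; if the change does not fit the current instruction, the
leader dies. The leader claims a counter to be zero by a broadcast on which all processes in this
counter die. So every step either simulates a step of the machine or lets a process die
(`Represents.step`), and death is irrevocable. When the machine has halted, the leader can call
all living processes to a final state, or send them back to the pool and restart the machine.

If the machine halts, enough processes can simulate it without losses, and then reach the final
state together or repeat the simulation forever. Conversely, if all processes reach the final
state, then none has died, and the simulation was faithful (`synchronizes_iff`). If the leader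
restarts infinitely often, then, as only finitely many processes can die, the simulation between
two late restarts was faithful (`repeatedlyCovers_iff`).

It remains to find counter machines with an undecidable halting problem, as finite objects that
depend computably on the input. By `Nat.Partrec.Code.evaln`, the halting problem is the search for
a zero of a primitive recursive function. Primitive recursive functions are computed by structured
counter programs (`Prog.computes_of_primrec`), and so is the search (`Prog.exists_search`). The
program that remains to be run serves as the control state, and only finitely many programs arise
in a run. The machine is thus fixed once and for all; the input only determines the length of a
chain of increments in front of it (`exists_machine_not_computablePred`), so that the transition
list is a constant list with a simple primitive recursive addition (`primrec_machineCode`).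
-/

namespace BroadcastNetwork

/-! ### Counter machines -/

/-- The instructions of a counter machine with control states `L` and counters `R`: stop, increment
a counter, or test a counter for zero and decrement it if it is positive. -/
inductive Instr (L R : Type*) where
  | halt : Instr L R
  | inc (r : R) (l : L) : Instr L R
  | dec (r : R) (ifZero ifPos : L) : Instr L R

/-- Renaming of control states and counters. -/
def Instr.map {L R L' R' : Type*} (f : L → L') (g : R → R') : Instr L R → Instr L' R'
  | .halt => .halt
  | .inc r l => .inc (g r) (f l)
  | .dec r l l' => .dec (g r) (f l) (f l')

/-- `Eval I l v v'`: the machine with program `I`, started in the control state `l` with counter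
values `v`, stops with counter values `v'`. -/
inductive Eval {L R : Type*} [DecidableEq R] (I : L → Instr L R) : L → (R → ℕ) → (R → ℕ) → Prop
  | halt {l v} : I l = .halt → Eval I l v v
  | inc {l v v' r l'} : I l = .inc r l' → Eval I l' (Function.update v r (v r + 1)) v' →
      Eval I l v v'
  | zero {l v v' r l₀ l₁} : I l = .dec r l₀ l₁ → v r = 0 → Eval I l₀ v v' → Eval I l v v'
  | pos {l v v' r l₀ l₁} : I l = .dec r l₀ l₁ → v r ≠ 0 →
      Eval I l₁ (Function.update v r (v r - 1)) v' → Eval I l v v'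

/-- The machine stops when started in the control state `l` with counter values `v`. -/
def Halts {L R : Type*} [DecidableEq R] (I : L → Instr L R) (l : L) (v : R → ℕ) : Prop :=
  ∃ v', Eval I l v v'

section Map

variable {L R L' R' : Type*} [DecidableEq R] [DecidableEq R'] {I : L → Instr L R}
  {I' : L' → Instr L' R'} {f : L → L'} {g : R → R'}

theorem update_comp_of_injective (hg : g.Injective) (s : R' → ℕ) (r : R) (n : ℕ) :
    Function.update s (g r) n ∘ g = Function.update (s ∘ g) r n := by
  ext r'
  by_cases h : r' = r
  · subst h; simp
  · simp [Function.update_of_ne h, Function.update_of_ne (hg.ne h)]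

/-- A machine halts if and only if its image under a renaming does. The renaming of control states
need not be injective. -/
theorem halts_map_iff (hg : g.Injective) (h : ∀ l, I' (f l) = (I l).map f g) (l : L)
    (s : R' → ℕ) : Halts I' (f l) s ↔ Halts I l (s ∘ g) := by
  constructor
  · rintro ⟨s', hs⟩
    generalize hm : f l = m at hs
    induction hs generalizing l with
    | halt h0 =>
      subst hm
      rw [h] at h0
      cases hi : I l with
      | halt => exact ⟨_, .halt hi⟩
      | inc r l => simp [hi, Instr.map] at h0
      | dec r l l' => simp [hi, Instr.map] at h0
    | inc h0 _ ih =>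
      subst hm
      rw [h] at h0
      cases hi : I l with
      | halt => simp [hi, Instr.map] at h0
      | inc r l =>
        simp only [hi, Instr.map, Instr.inc.injEq] at h0
        obtain ⟨rfl, rfl⟩ := h0
        obtain ⟨w, hw⟩ := ih _ rfl
        rw [update_comp_of_injective hg] at hw
        exact ⟨w, .inc hi hw⟩
      | dec r l l' => simp [hi, Instr.map] at h0
    | zero h0 hz _ ih =>
      subst hm
      rw [h] at h0
      cases hi : I l with
      | halt => simp [hi, Instr.map] at h0
      | inc r l => simp [hi, Instr.map] at h0
      | dec r l l' =>
        simp only [hi, Instr.map, Instr.dec.injEq] at h0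
        obtain ⟨rfl, rfl, rfl⟩ := h0
        obtain ⟨w, hw⟩ := ih _ rfl
        exact ⟨w, .zero hi hz hw⟩
    | pos h0 hz _ ih =>
      subst hm
      rw [h] at h0
      cases hi : I l with
      | halt => simp [hi, Instr.map] at h0
      | inc r l => simp [hi, Instr.map] at h0
      | dec r l l' =>
        simp only [hi, Instr.map, Instr.dec.injEq] at h0
        obtain ⟨rfl, rfl, rfl⟩ := h0
        obtain ⟨w, hw⟩ := ih _ rfl
        rw [update_comp_of_injective hg] at hw
        exact ⟨w, .pos hi hz hw⟩
  · rintro ⟨v', hv⟩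
    generalize hw : s ∘ g = v at hv
    induction hv generalizing s with
    | halt h0 => exact ⟨_, .halt (by rw [h, h0]; rfl)⟩
    | inc h0 _ ih =>
      subst hw
      obtain ⟨w, hw⟩ := ih _ (update_comp_of_injective hg _ _ _)
      exact ⟨w, .inc (by rw [h, h0]; rfl) hw⟩
    | zero h0 hz _ ih =>
      subst hw
      obtain ⟨w, hw⟩ := ih _ rfl
      exact ⟨w, .zero (by rw [h, h0]; rfl) hz hw⟩
    | pos h0 hz _ ih =>
      subst hw
      obtain ⟨w, hw⟩ := ih _ (update_comp_of_injective hg _ _ _)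
      exact ⟨w, .pos (by rw [h, h0]; rfl) hz hw⟩

end Map

/-! ### Counter programs -/

/-- Structured counter programs. `loop r body next` repeats "decrement `r` and run `body`" until `r`
is zero and goes on with `next`. -/
inductive Prog where
  | halt : Prog
  | inc (r : ℕ) (next : Prog) : Prog
  | loop (r : ℕ) (body next : Prog) : Prog

namespace Prog

/-- Sequential composition. -/
def append : Prog → Prog → Prog
  | halt, q => q
  | inc r k, q => inc r (k.append q)
  | loop r b k, q => loop r b (k.append q)

instance : Append Prog := ⟨append⟩

@[simp] theorem halt_append (q : Prog) : halt ++ q = q := rfl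

@[simp] theorem inc_append (r : ℕ) (k q : Prog) : inc r k ++ q = inc r (k ++ q) := rfl

@[simp] theorem loop_append (r : ℕ) (b k q : Prog) : loop r b k ++ q = loop r b (k ++ q) := rfl

theorem append_assoc (p q t : Prog) : p ++ q ++ t = p ++ (q ++ t) := by
  induction p with
  | halt => rfl
  | inc r k ih => simp [ih]
  | loop r b k _ ih => simp [ih]

/-- Programs are the control states of one infinite counter machine: the control state is the
program that remains to be run. -/
def instr : Prog → Instr Prog ℕ
  | halt => .halt
  | inc r k => .inc r k
  | loop r b k => .dec r k (b ++ loop r b k)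

/-- `p.Run s s'`: the program `p` turns the counter values `s` into `s'`. -/
abbrev Run (p : Prog) (s s' : ℕ → ℕ) : Prop := Eval instr p s s'

variable {p q : Prog} {s s' s'' : ℕ → ℕ}

theorem Run.append (hp : p.Run s s') (hq : q.Run s' s'') : (p ++ q).Run s s'' := by
  induction hp with
  | @halt l v h =>
    cases l with
    | halt => exact hq
    | inc => cases h
    | loop => cases h
  | @inc l v v' r l' h _ ih =>
    cases l with
    | halt => cases h
    | inc => cases h; exact .inc rfl (ih hq)
    | loop => cases h
  | @zero l v v' r l₀ l₁ h hz _ ih =>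
    cases l with
    | halt => cases h
    | inc => cases h
    | loop => cases h; exact .zero rfl hz (ih hq)
  | @pos l v v' r l₀ l₁ h hz _ ih =>
    cases l with
    | halt => cases h
    | inc => cases h
    | loop =>
      cases h
      refine .pos rfl hz ?_
      have := ih hq
      rwa [append_assoc, loop_append] at this

/-- A loop whose counter starts at `N` passes through the states `σ N, …, σ 0`, if the body leads
from each one to the next. -/
theorem run_loop {r : ℕ} {b : Prog} (σ : ℕ → ℕ → ℕ) {N : ℕ} (hr : ∀ n ≤ N, σ n r = n)
    (hb : ∀ n < N, b.Run (Function.update (σ (n + 1)) r n) (σ n)) :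
    (loop r b halt).Run (σ N) (σ 0) := by
  induction N with
  | zero => exact .zero rfl (hr 0 le_rfl) (.halt rfl)
  | succ n ih =>
    refine .pos rfl (by simp [hr (n + 1)]) ?_
    have := (hb n n.lt_succ_self).append (ih (fun m hm => hr m (by omega))
      (fun m hm => hb m (by omega)))
    simpa [hr (n + 1)] using this

/-- A loop does not terminate if its counter is positive in each of the states `σ k` and its body
leads from `σ k` to `σ (k + 1)`. -/
theorem not_run_loop {r : ℕ} {b q : Prog} (σ : ℕ → ℕ → ℕ) (hr : ∀ k, σ k r ≠ 0)
    (hb : ∀ k, b.Run (Function.update (σ k) r (σ k r - 1)) (σ (k + 1))) (k : ℕ) :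
    ¬ Halts instr (loop r b q) (σ k) := by
  -- The statement is strengthened to programs that reach the head of the loop in a state `σ k`.
  have key : ∀ l v v', Eval instr l v v' → ∀ p k, l = p ++ loop r b q → p.Run v (σ k) → False := by
    intro l v v' h
    induction h with
    | @halt l v h =>
      rintro p k rfl -
      cases p <;> cases h
    | @inc l v v' r' l' h _ ih =>
      rintro p k rfl hp
      cases p with
      | halt => cases h
      | loop => cases h
      | inc r'' p =>
        cases h
        cases hp with
        | halt h => cases h
        | inc h h' => cases h; exact ih p k rfl h'
        | zero h => cases h
        | pos h => cases h
    | @zero l v v' r' l₀ l₁ h hz _ ih =>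
      rintro p k rfl hp
      cases p with
      | halt =>
        cases h
        cases hp with
        | halt => exact hr k hz
        | inc h => cases h
        | zero h => cases h
        | pos h => cases h
      | inc => cases h
      | loop r'' b'' p =>
        cases h
        cases hp with
        | halt h => cases h
        | inc h h' => cases h
        | zero h _ h' => cases h; exact ih p k rfl h'
        | pos h h' => cases h; exact h' hz
    | @pos l v v' r' l₀ l₁ h hz _ ih =>
      rintro p k rfl hp
      cases p with
      | halt =>
        cases h
        cases hp with
        | halt => exact ih b (k + 1) rfl (hb k)
        | inc h => cases h
        | zero h => cases h
        | pos h => cases h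
      | inc => cases h
      | loop r'' b'' p =>
        cases h
        cases hp with
        | halt h => cases h
        | inc h h' => cases h
        | zero h h' => cases h; exact hz h'
        | pos h _ h' => cases h; exact ih (b'' ++ loop r' b'' p) k (by simp [append_assoc]; rfl) h'
  rintro ⟨v', h⟩
  exact key _ _ _ h halt k rfl (.halt rfl)

/-- Reset the counter `a`. -/
def clear (a : ℕ) : Prog := loop a halt halt

theorem run_clear (a : ℕ) (s : ℕ → ℕ) : (clear a).Run s (Function.update s a 0) := by
  have := run_loop (r := a) (b := halt) (N := s a) (fun n => Function.update s a n) (by simp)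
    (fun n _ => by simpa using Eval.halt rfl)
  rwa [Function.update_eq_self] at this

theorem Run.of_eq (h : p.Run s s') (h' : ∀ r, s' r = s'' r) : p.Run s s'' :=
  (funext h' : s' = s'') ▸ h

theorem run_inc (a : ℕ) (s : ℕ → ℕ) : (inc a halt).Run s (Function.update s a (s a + 1)) :=
  .inc rfl (.halt rfl)

/-- Add the counter `a` to the counter `o` and reset `a`. -/
def move (a o : ℕ) : Prog := loop a (inc o halt) halt

theorem run_move {a o : ℕ} (h : a ≠ o) (s : ℕ → ℕ) :
    (move a o).Run s (Function.update (Function.update s a 0) o (s o + s a)) := by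
  have := run_loop (r := a) (b := inc o halt) (N := s a)
    (fun n => Function.update (Function.update s a n) o (s o + (s a - n))) (by simp [h])
    (fun n hn => by
      refine (run_inc _ _).of_eq fun x => ?_
      grind [Function.update_apply])
  refine (Eq.mp ?_ this : (move a o).Run _ _)
  simp only [Function.update_eq_self, Nat.sub_self, Nat.add_zero, Nat.sub_zero, move]

/-- Add the counter `a` to the counter `o`, with the help of a counter `t` that is zero. -/
def add (a o t : ℕ) : Prog := move a t ++ loop t (inc a (inc o halt)) halt

theorem run_add {a o t : ℕ} (hao : a ≠ o) (hat : a ≠ t) (hot : o ≠ t) {s : ℕ → ℕ} (ht : s t = 0) :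
    (add a o t).Run s (Function.update s o (s o + s a)) := by
  have := run_loop (r := t) (b := inc a (inc o halt)) (N := s a)
    (fun n => Function.update (Function.update (Function.update s a (s a - n)) t n) o
      (s o + (s a - n))) (by simp [hot.symm])
    (fun n hn => by
      refine ((run_inc a _).append (run_inc o _)).of_eq fun x => ?_
      grind [Function.update_apply])
  have h0 : Function.update (Function.update s a 0) t (s t + s a) = Function.update (Function.update
      (Function.update s a (s a - s a)) t (s a)) o (s o + (s a - s a)) := by
    funext x
    grind [Function.update_apply]
  refine ((run_move hat s).append (h0 ▸ this)).of_eq fun x => ?_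
  grind [Function.update_apply]

/-- `f` is computed by counter programs: for all argument counters, an output counter different from
them, and a bound `b` on these such that all counters from `b` on are zero, there is a program that
adds the value of `f` to the output counter and leaves all other counters as they were. -/
def Computes {n : ℕ} (f : List.Vector ℕ n → ℕ) : Prop :=
  ∀ (args : List.Vector ℕ n) (out b : ℕ), (∀ i, args.get i < b ∧ args.get i ≠ out) → out < b →
    ∃ p : Prog, ∀ s : ℕ → ℕ, (∀ r, b ≤ r → s r = 0) →
      p.Run s (Function.update s out (s out + f (args.map s)))

theorem computes_zero : Computes (n := 0) fun _ => 0 :=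
  fun _ _ _ _ _ => ⟨halt, fun _ _ => by simpa using Eval.halt rfl⟩

theorem computes_get {n : ℕ} (i : Fin n) : Computes fun v => v.get i := by
  intro args out b ha ho
  refine ⟨add (args.get i) out b, fun s hs => ?_⟩
  have := run_add (ha i).2 (ha i).1.ne ho.ne (hs b le_rfl)
  simpa [List.Vector.get_map] using this

theorem computes_succ : Computes (n := 1) fun v => v.head.succ := by
  intro args out b ha ho
  obtain ⟨p, hp⟩ := computes_get (0 : Fin 1) args out b ha ho
  refine ⟨p ++ inc out halt, fun s hs => ?_⟩
  convert (hp s hs).append (run_inc out _) using 1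
  simp [Nat.succ_eq_add_one, add_assoc]

/-- The program that resets the `k` counters from `b` on. -/
theorem exists_run_clear (b k : ℕ) :
    ∃ p : Prog, ∀ s, p.Run s (fun r => if b ≤ r ∧ r < b + k then 0 else s r) := by
  induction k with
  | zero => exact ⟨halt, fun s => Run.of_eq (.halt rfl) fun x => by grind⟩
  | succ k ih =>
    obtain ⟨p, hp⟩ := ih
    refine ⟨p ++ clear (b + k), fun s => ?_⟩
    convert (hp s).append (run_clear _ _) using 1
    funext x
    grind [Function.update_apply]

theorem computes_comp {m n : ℕ} {f : List.Vector ℕ n → ℕ} (g : Fin n → List.Vector ℕ m → ℕ)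
    (hf : Computes f) (hg : ∀ i, Computes (g i)) :
    Computes fun a => f (List.Vector.ofFn fun i => g i a) := by
  intro args out b ha ho
  -- The counters `b, …, b + n - 1` receive the values of the functions `g i`; `fill s k` is the
  -- state `s` after the first `k` of them have been computed.
  obtain ⟨fill, fill_eq⟩ : ∃ fill : (ℕ → ℕ) → ℕ → ℕ → ℕ, ∀ s k r, fill s k r =
      if h : r - b < n then
        if b ≤ r ∧ r < b + k then g ⟨r - b, h⟩ (args.map s) else s r else s r :=
    ⟨_, fun _ _ _ => rfl⟩
  have map_fill : ∀ s k, args.map (fill s k) = args.map s := by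
    intro s k
    ext i
    have := (ha i).1
    simp only [List.Vector.get_map, fill_eq]
    grind
  have hfill : ∀ k ≤ n, ∃ p : Prog, ∀ s : ℕ → ℕ, (∀ r, b ≤ r → s r = 0) → p.Run s (fill s k) := by
    intro k hk
    induction k with
    | zero => exact ⟨halt, fun s _ => Run.of_eq (.halt rfl) fun x => by grind⟩
    | succ k ih =>
      obtain ⟨p, hp⟩ := ih (by omega)
      obtain ⟨q, hq⟩ := hg ⟨k, hk⟩ args (b + k) (b + n)
        (fun i => ⟨by have := (ha i).1; omega, by have := (ha i).1; omega⟩) (by omega)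
      refine ⟨p ++ q, fun s hs => ?_⟩
      have h1 := hq (fill s k) (fun r hr => by have := hs r (by omega); grind)
      rw [map_fill] at h1
      refine ((hp s hs).append h1).of_eq fun x => ?_
      have := hs (b + k) (by omega)
      rw [Function.update_apply, fill_eq, fill_eq, fill_eq]
      by_cases hx : x = b + k
      · subst hx; simp [this, show k < n from hk]
      · grind
  obtain ⟨p, hp⟩ := hfill n le_rfl
  obtain ⟨q, hq⟩ := hf (List.Vector.ofFn fun i => b + i) out (b + n)
    (fun i => by simp only [List.Vector.get_ofFn]; omega) (by omega)
  obtain ⟨c, hc⟩ := exists_run_clear b n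
  refine ⟨p ++ (q ++ c), fun s hs => ?_⟩
  have h1 := hq (fill s n) (fun r hr => by have := hs r (by omega); grind)
  have h2 : (List.Vector.ofFn fun i : Fin n => b + (i : ℕ)).map (fill s n) =
      List.Vector.ofFn fun i => g i (args.map s) := by
    ext i
    simp [List.Vector.get_map, fill_eq]
  rw [h2] at h1
  refine ((hp s hs).append (h1.append (hc _))).of_eq fun x => ?_
  have := hs x
  simp only [Function.update_apply, fill_eq]
  grind

theorem computes_prec {n : ℕ} {f : List.Vector ℕ n → ℕ} {g : List.Vector ℕ (n + 2) → ℕ}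
    (hf : Computes f) (hg : Computes g) :
    Computes fun v : List.Vector ℕ (n + 1) =>
      v.head.rec (f v.tail) fun y IH => g (y ::ᵥ IH ::ᵥ v.tail) := by
  intro args out b ha ho
  have ha₀ : args.head < b ∧ args.head ≠ out := by simpa using ha 0
  have ha₁ : ∀ i, args.tail.get i < b ∧ args.tail.get i ≠ out := fun i => by
    simpa [List.Vector.get_tail_succ] using ha i.succ
  -- The counters from `b` on hold the number of remaining rounds, the number of completed rounds,
  -- the last value, and the next value.
  obtain ⟨p, hp⟩ := hf args.tail (b + 2) (b + 4)
    (fun i => by have := ha₁ i; omega) (by omega)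
  obtain ⟨q, hq⟩ := hg ((b + 1) ::ᵥ (b + 2) ::ᵥ args.tail) (b + 3) (b + 4)
    (fun i => by
      refine Fin.cases ?_ (fun i => Fin.cases ?_ (fun i => ?_) i) i
      · simp
      · rw [List.Vector.get_cons_succ, List.Vector.get_cons_zero]
        omega
      · have := ha₁ i
        simp only [List.Vector.get_cons_succ]
        omega) (by omega)
  refine ⟨add args.head b (b + 4) ++ (p ++
    (loop b (q ++ (clear (b + 2) ++ (move (b + 3) (b + 2) ++ inc (b + 1) halt))) halt ++
    (move (b + 2) out ++ clear (b + 1)))), fun s hs => ?_⟩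
  obtain ⟨R, hR₀, hR⟩ : ∃ R : ℕ → ℕ, R 0 = f (args.tail.map s) ∧
      ∀ k, R (k + 1) = g (k ::ᵥ R k ::ᵥ args.tail.map s) :=
    ⟨fun k => k.rec (f (args.tail.map s)) fun y IH => g (y ::ᵥ IH ::ᵥ args.tail.map s),
      rfl, fun _ => rfl⟩
  have hR' : ∀ k, (k.rec (f (args.tail.map s))
      (fun y IH => g (y ::ᵥ IH ::ᵥ args.tail.map s)) : ℕ) = R k := by
    intro k
    induction k with
    | zero => exact hR₀.symm
    | succ k ih => rw [hR, ← ih]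
  obtain ⟨N, hN⟩ : ∃ N, N = s args.head := ⟨_, rfl⟩
  obtain ⟨σ, σ_eq⟩ : ∃ σ : ℕ → ℕ → ℕ, ∀ n r, σ n r =
      if r = b then n else if r = b + 1 then N - n else if r = b + 2 then R (N - n) else s r :=
    ⟨_, fun _ _ => rfl⟩
  have hmap : ∀ t : ℕ → ℕ, (∀ r < b, t r = s r) → args.tail.map t = args.tail.map s := by
    intro t ht
    ext i
    simp only [List.Vector.get_map]
    exact ht _ (ha₁ i).1
  have h1 := run_add (a := args.head) (o := b) (t := b + 4) (s := s) (by omega) (by omega)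
    (by omega) (hs _ (by omega))
  have h2 := hp (Function.update s b (s b + s args.head)) (fun r hr => by
    have := hs r (by omega); grind [Function.update_apply])
  rw [hmap _ (fun r hr => Function.update_of_ne (by omega) _ _), ← hR₀] at h2
  have h12 := (h1.append h2).of_eq (s'' := σ N) fun x => by
    have := hs b le_rfl
    have := hs (b + 1) (by omega)
    have := hs (b + 2) (by omega)
    grind [Function.update_apply]
  have h3 := run_loop (r := b)
    (b := q ++ (clear (b + 2) ++ (move (b + 3) (b + 2) ++ inc (b + 1) halt))) (N := N) σ
    (fun n _ => by grind) (fun n hn => by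
      have h1 := hq (Function.update (σ (n + 1)) b n) (fun r hr => by
        have := hs r (by omega)
        grind [Function.update_apply])
      have h2 : ((b + 1) ::ᵥ (b + 2) ::ᵥ args.tail).map (Function.update (σ (n + 1)) b n) =
          (N - (n + 1)) ::ᵥ R (N - (n + 1)) ::ᵥ args.tail.map s := by
        rw [List.Vector.map_cons, List.Vector.map_cons,
          hmap _ (fun r hr => by grind [Function.update_apply])]
        simp [σ_eq]
      rw [h2, ← hR] at h1
      refine (h1.append ((run_clear _ _).append
        ((run_move (by omega) _).append (run_inc _ _)))).of_eq fun x => ?_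
      have := hs (b + 3) (by omega)
      rw [show N - (n + 1) + 1 = N - n by omega]
      simp only [Function.update_apply, σ_eq]
      grind)
  refine (h12.append (h3.append ((run_move (by omega) _).append (run_clear _ _)))).of_eq fun x => ?_
  have := hs b le_rfl
  have := hs (b + 1) (by omega)
  have := hs (b + 2) (by omega)
  have h4 : (args.map s).head = N := by rw [hN, ← List.Vector.get_zero, List.Vector.get_map]; simp
  have h5 : (args.map s).tail = args.tail.map s := by
    ext i
    simp [List.Vector.get_map, List.Vector.get_tail_succ]
  simp only [h4, h5, hR', Function.update_apply, σ_eq]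
  grind

theorem computes_of_primrec {n : ℕ} {f : List.Vector ℕ n → ℕ} (hf : Nat.Primrec' f) :
    Computes f := by
  induction hf with
  | zero => exact computes_zero
  | succ => exact computes_succ
  | get i => exact computes_get i
  | comp g _ _ ihf ihg => exact computes_comp g ihf ihg
  | prec _ _ ihf ihg => exact computes_prec ihf ihg

/-- Unbounded search for a zero of a primitive recursive function by a counter program that gets the
parameter in the counter `0`. -/
theorem exists_search {f : ℕ → ℕ → ℕ} (hf : Primrec₂ f) :
    ∃ p : Prog, ∀ x, Halts instr p (Function.update 0 0 x) ↔ ∃ k, f k x = 0 := by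
  -- The counters `1`, `2`, `3` hold the candidate `k`, the value of `f` at it, and a flag that
  -- tells whether the search goes on.
  obtain ⟨p, hp⟩ := computes_of_primrec (Nat.Primrec'.prim_iff₂.2 hf) (1 ::ᵥ 0 ::ᵥ .nil) 2 4
    (fun i => by
      refine Fin.cases ?_ (fun i => ?_) i
      · simp
      · rw [List.Vector.get_cons_succ, Subsingleton.elim i 0, List.Vector.get_cons_zero]
        omega) (by omega)
  obtain ⟨S, S_eq⟩ : ∃ S : ℕ → ℕ → ℕ → ℕ → ℕ, ∀ x k a r, S x k a r =
      if r = 0 then x else if r = 1 then k else if r = 3 then a else 0 := ⟨_, fun _ _ _ _ => rfl⟩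
  have htest : ∀ s : ℕ → ℕ, (loop 2 (clear 2 ++ inc 3 halt) halt).Run s
      (if s 2 = 0 then s else Function.update (Function.update s 2 0) 3 (s 3 + 1)) := by
    intro s
    split_ifs with h
    · exact .zero rfl h (.halt rfl)
    · refine .pos rfl h ?_
      have := ((run_clear 2 (Function.update s 2 (s 2 - 1))).append
        (run_inc 3 _)).append (q := loop 2 (clear 2 ++ inc 3 halt) halt)
        (.zero rfl (by simp) (.halt rfl))
      refine this.of_eq fun r => ?_
      grind [Function.update_apply]
  let body := p ++ (loop 2 (clear 2 ++ inc 3 halt) halt ++ inc 1 halt)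
  have hbody : ∀ x k, body.Run (S x k 0) (S x (k + 1) (if f k x = 0 then 0 else 1)) := by
    intro x k
    have h1 := hp (S x k 0) (fun r hr => by grind)
    refine (h1.append ((htest _).append (run_inc _ _))).of_eq fun r => ?_
    simp only [List.Vector.map_cons, List.Vector.head_cons, List.Vector.tail_cons,
      Function.update_apply, S_eq]
    grind
  have hdec : ∀ x k, Function.update (S x k 1) 3 (S x k 1 3 - 1) = S x k 0 := by
    intro x k
    funext r
    grind [Function.update_apply]
  have hinit : ∀ x, Function.update (Function.update (0 : ℕ → ℕ) 0 x) 3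
      (Function.update (0 : ℕ → ℕ) 0 x 3 + 1) = S x 0 1 := by
    intro x
    funext r
    simp only [Function.update_apply, S_eq, Pi.zero_apply]
    grind
  refine ⟨inc 3 (loop 3 body halt), fun x => ⟨?_, ?_⟩⟩
  · rintro ⟨s', h⟩
    by_contra! hne
    cases h with
    | halt h => cases h
    | zero h => cases h
    | pos h => cases h
    | inc h h' =>
      cases h
      rw [hinit] at h'
      refine not_run_loop (r := 3) (S x · 1) (fun k => by simp [S_eq]) (fun k => ?_) 0 ⟨s', h'⟩
      have := hbody x k
      rw [if_neg (hne k)] at this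
      rwa [hdec]
  · rintro ⟨d, hd⟩
    have hexit : ∀ j, f j x = 0 → Halts instr (loop 3 body halt) (S x j 1) := fun j hj => by
      have := hbody x j
      rw [if_pos hj] at this
      exact ⟨_, .pos rfl (by simp [S_eq]) (hdec x j ▸ this.append
        (.zero rfl (by simp [S_eq]) (.halt rfl)))⟩
    have key : ∀ d j, f (j + d) x = 0 → Halts instr (loop 3 body halt) (S x j 1) := by
      intro d
      induction d with
      | zero => exact hexit
      | succ d ih =>
        intro j hj
        by_cases h : f j x = 0
        · exact hexit j h
        · have h1 := hbody x j
          rw [if_neg h] at h1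
          obtain ⟨s', hs⟩ := ih (j + 1) (by rwa [show j + 1 + d = j + (d + 1) by omega])
          exact ⟨s', .pos rfl (by simp [S_eq]) (hdec x j ▸ h1.append hs)⟩
    obtain ⟨s', hs⟩ := key d 0 (by simpa using hd)
    exact ⟨s', .inc rfl (hinit x ▸ hs)⟩

end Prog

/-- The halting problem as a search for a zero of a primitive recursive function. -/
theorem exists_primrec_not_computablePred :
    ∃ f : ℕ → ℕ → ℕ, Primrec₂ f ∧ ¬ ComputablePred fun x => ∃ k, f k x = 0 := by
  let f : ℕ → ℕ → ℕ := fun k x =>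
    if (Nat.Partrec.Code.evaln k (Denumerable.ofNat Nat.Partrec.Code x) 0).isSome then 0 else 1
  refine ⟨f, ?_, fun h => ComputablePred.halting_problem 0 ?_⟩
  · have h1 : Primrec fun p : ℕ × ℕ =>
        Nat.Partrec.Code.evaln p.1 (Denumerable.ofNat Nat.Partrec.Code p.2) 0 :=
      Nat.Partrec.Code.primrec_evaln.comp
        ((Primrec.fst.pair ((Primrec.ofNat _).comp Primrec.snd)).pair (Primrec.const 0))
    have h2 := Primrec.option_isSome.comp h1
    exact Primrec.ite (Primrec.eq.comp h2 (Primrec.const true)) (Primrec.const 0) (Primrec.const 1)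
  · refine ComputablePred.computable_of_manyOneReducible ⟨Encodable.encode, Computable.encode, ?_⟩ h
    intro c
    have hc : (∃ k, f k (Encodable.encode c) = 0) ↔
        ∃ k, (Nat.Partrec.Code.evaln k c 0).isSome := by
      simp [f, Option.isSome_iff_ne_none]
    change (c.eval 0).Dom ↔ _
    rw [hc, Part.dom_iff_mem]
    simp only [Nat.Partrec.Code.evaln_complete, Option.isSome_iff_exists, Option.mem_def]
    exact exists_comm

/-! ### A counter machine with a variable number of loading instructions -/

/-- All control states that the instruction leads to satisfy `p`, and its counter satisfies `c`. -/
def Instr.Forall {L R : Type*} (p : L → Prop) (c : R → Prop) : Instr L R → Prop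
  | .halt => True
  | .inc r l => c r ∧ p l
  | .dec r l l' => c r ∧ p l ∧ p l'

namespace Prog

/-- The programs that can remain while `p` is run. -/
def reach : Prog → Set Prog
  | halt => {halt}
  | inc r k => insert (inc r k) (reach k)
  | loop r b k => insert (loop r b k) (reach k ∪ (· ++ loop r b k) '' reach b)

theorem finite_reach (p : Prog) : p.reach.Finite := by
  induction p with
  | halt => exact Set.finite_singleton _
  | inc r k ih => exact ih.insert _
  | loop r b k ihb ihk => exact (ihk.union (ihb.image _)).insert _

theorem self_mem_reach (p : Prog) : p ∈ p.reach := by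
  cases p <;> simp [reach]

theorem halt_mem_reach (p : Prog) : halt ∈ p.reach := by
  induction p with
  | halt => rfl
  | inc r k ih => exact Or.inr ih
  | loop r b k _ ih => exact Or.inr (Or.inl ih)

/-- The set of remaining programs is closed under steps. -/
theorem forall_reach (p : Prog) : ∀ q ∈ p.reach, q.instr.Forall (· ∈ p.reach) fun _ => True := by
  induction p with
  | halt =>
    rintro q rfl
    trivial
  | inc r k ih =>
    rintro q (rfl | hq)
    · exact ⟨trivial, Or.inr k.self_mem_reach⟩
    · have := ih q hq
      cases q with
      | halt => trivial
      | inc => exact ⟨trivial, Or.inr this.2⟩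
      | loop => exact ⟨trivial, Or.inr this.2.1, Or.inr this.2.2⟩
  | loop r b k ihb ihk =>
    have hloop : (instr (loop r b k)).Forall (· ∈ (loop r b k).reach) fun _ => True :=
      ⟨trivial, Or.inr (Or.inl k.self_mem_reach), Or.inr (Or.inr ⟨b, b.self_mem_reach, rfl⟩)⟩
    rintro q (rfl | hq | ⟨q, hq, rfl⟩)
    · exact hloop
    · have := ihk q hq
      cases q with
      | halt => trivial
      | inc => exact ⟨trivial, Or.inr (Or.inl this.2)⟩
      | loop => exact ⟨trivial, Or.inr (Or.inl this.2.1), Or.inr (Or.inl this.2.2)⟩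
    · have := ihb q hq
      cases q with
      | halt => exact hloop
      | inc => exact ⟨trivial, Or.inr (Or.inr ⟨_, this.2, rfl⟩)⟩
      | loop r' b' k' =>
        exact ⟨trivial, Or.inr (Or.inr ⟨_, this.2.1, rfl⟩),
          Or.inr (Or.inr ⟨_, this.2.2, by simp [append_assoc]; rfl⟩)⟩

/-- The counter that the first instruction of a program acts on. -/
def headReg : Prog → ℕ
  | halt => 0
  | inc r _ => r
  | loop r _ _ => r

/-- The program that increments the counter `0` `n` times before running `p`. -/
def load (p : Prog) : ℕ → Prog
  | 0 => p
  | n + 1 => inc 0 (load p n)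

theorem halts_load (p : Prog) (n : ℕ) (s : ℕ → ℕ) :
    Halts instr (p.load n) s ↔ Halts instr p (Function.update s 0 (s 0 + n)) := by
  induction n generalizing s with
  | zero => simp [load]
  | succ n ih =>
    have := ih (Function.update s 0 (s 0 + 1))
    rw [Function.update_idem, Function.update_self, add_assoc, add_comm 1] at this
    rw [← this]
    constructor
    · rintro ⟨s', h⟩
      cases h with
      | halt h => cases h
      | zero h => cases h
      | pos h => cases h
      | inc h h' => cases h; exact ⟨s', h'⟩
    · rintro ⟨s', h⟩
      exact ⟨s', .inc rfl h⟩

end Prog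

/-- There is a fixed counter machine whose halting on input `x` is undecidable, given as follows:
the control states below `F` form the machine proper, with `B` counters and the only halting
control state `h`; a run starts in `F + x` with all counters zero, and the instruction at `F + j`
increments the counter `0` and goes on to `F + j - 1` or, for `j = 0`, to the entry point `i`. -/
theorem exists_machine_not_computablePred :
    ∃ (F B i h : ℕ) (I : ℕ → Instr ℕ ℕ), 0 < B ∧ i < F ∧ h < F ∧
      (∀ l < F, (I l).Forall (· < F) (· < B)) ∧ (∀ l, I l = .halt ↔ l = h) ∧
      (∀ j, I (F + j) = .inc 0 (if j = 0 then i else F + j - 1)) ∧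
      ¬ ComputablePred fun x => Halts I (F + x) 0 := by
  obtain ⟨f, hf, hf'⟩ := exists_primrec_not_computablePred
  -- A start in `F + x` loads the number `x + 1`.
  obtain ⟨p, hp⟩ := Prog.exists_search (f := fun k x => f k (x - 1))
    (hf.comp Primrec.fst (Primrec.pred.comp Primrec.snd))
  have := p.finite_reach.to_subtype
  obtain ⟨F, ⟨e⟩⟩ := Finite.exists_equiv_fin p.reach
  obtain ⟨B, hB⟩ := (p.finite_reach.image Prog.headReg).bddAbove
  replace hB : ∀ q ∈ p.reach, q.headReg < B + 1 := fun q hq =>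
    Nat.lt_succ_of_le (hB ⟨q, hq, rfl⟩)
  classical
  -- The numbering of control states, and the programs that they stand for.
  obtain ⟨num, hnum⟩ : ∃ num : Prog → ℕ, ∀ q (hq : q ∈ p.reach), num q = e ⟨q, hq⟩ :=
    ⟨fun q => if hq : q ∈ p.reach then e ⟨q, hq⟩ else 0, fun q hq => by simp [hq]⟩
  have num_lt : ∀ q ∈ p.reach, num q < F := fun q hq => by rw [hnum q hq]; exact Fin.is_lt _
  obtain ⟨prog, hprog⟩ : ∃ prog : ℕ → Prog, ∀ l, prog l =
      if h : l < F then (e.symm ⟨l, h⟩ : Prog) else p.load (l - F + 1) := ⟨_, fun _ => rfl⟩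
  have prog_num : ∀ q ∈ p.reach, prog (num q) = q := fun q hq => by
    rw [hprog, dif_pos (num_lt q hq)]
    simp [hnum q hq]
  have prog_mem : ∀ l < F, prog l ∈ p.reach := fun l hl => by
    rw [hprog, dif_pos hl]
    exact Subtype.coe_prop _
  have num_prog : ∀ l < F, num (prog l) = l := fun l hl => by
    rw [hnum _ (prog_mem l hl)]
    simp [hprog, dif_pos hl]
  have prog_add : ∀ j, prog (F + j) = p.load (j + 1) := fun j => by simp [hprog]
  obtain ⟨I, hI⟩ : ∃ I : ℕ → Instr ℕ ℕ, ∀ l, I l = if l < F then (prog l).instr.map num id else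
      .inc 0 (if l - F = 0 then num p else l - 1) := ⟨_, fun _ => rfl⟩
  have hIF : ∀ j, I (F + j) = .inc 0 (if j = 0 then num p else F + j - 1) := fun j => by
    simp [hI]
  have hmap : ∀ l, (prog l).instr = (I l).map prog id := by
    intro l
    by_cases hl : l < F
    · have := p.forall_reach _ (prog_mem l hl)
      rw [hI, if_pos hl]
      generalize (prog l).instr = i at *
      cases i with
      | halt => rfl
      | inc => simp [Instr.map, prog_num _ this.2]
      | dec => simp [Instr.map, prog_num _ this.2.1, prog_num _ this.2.2]
    · obtain ⟨j, rfl⟩ := Nat.exists_eq_add_of_le (not_lt.1 hl)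
      rw [hIF, prog_add]
      cases j with
      | zero => simp [Prog.load, Prog.instr, Instr.map, prog_num _ p.self_mem_reach]
      | succ j =>
        rw [if_neg (by omega), show F + (j + 1) - 1 = F + j by omega]
        simp [Prog.load, Prog.instr, Instr.map, prog_add]
  refine ⟨F, B + 1, num p, num .halt, I, by omega, num_lt _ p.self_mem_reach,
    num_lt _ p.halt_mem_reach, fun l hl => ?_, fun l => ?_, hIF,
    fun hU => hf' (hU.of_eq fun x => ?_)⟩
  · have h1 := p.forall_reach _ (prog_mem l hl)
    have h2 := hB _ (prog_mem l hl)
    rw [hI, if_pos hl]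
    cases h : prog l with
    | halt => trivial
    | inc =>
      rw [h] at h1 h2
      exact ⟨h2, num_lt _ h1.2⟩
    | loop =>
      rw [h] at h1 h2
      exact ⟨h2, num_lt _ h1.2.1, num_lt _ h1.2.2⟩
  · by_cases hl : l < F
    · rw [hI, if_pos hl]
      constructor
      · intro h
        rw [← num_prog l hl]
        cases h' : prog l with
        | halt => rfl
        | inc => rw [h'] at h; cases h
        | loop => rw [h'] at h; cases h
      · rintro rfl
        rw [prog_num _ p.halt_mem_reach]
        rfl
    · rw [hI, if_neg hl]
      have := num_lt _ p.halt_mem_reach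
      exact ⟨fun h => (by cases h), fun h => by omega⟩
  · have := halts_map_iff (g := id) Function.injective_id hmap (F + x) 0
    rw [Function.comp_id] at this
    rw [← this, prog_add, Prog.halts_load]
    simpa using hp (x + 1)

/-! ### The broadcast protocol of a counter machine -/

/-- The states of the protocol of a counter machine: a leader holds the control state, the value of
a counter `r` is the number of processes in the state `counter r`, and the pool provides further
processes. -/
inductive St (L R : Type*) where
  | init : St L R
  | pool : St L R
  | dead : St L R
  | final : St L R
  | leader (l : L) : St L R
  | counter (r : R) : St L R
  deriving DecidableEq

/-- The messages of the protocol of a counter machine. -/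
inductive Msg (R : Type*) where
  | start : Msg R
  | reset : Msg R
  | done : Msg R
  | inc (r : R) : Msg R
  | dec (r : R) : Msg R
  | zero (r : R) : Msg R

instance {L R : Type*} [Finite L] [Finite R] : Finite (St L R) :=
  Finite.of_surjective (α := Fin 4 ⊕ L ⊕ R)
    (fun | .inl i => ![.init, .pool, .dead, .final] i
         | .inr (.inl l) => .leader l
         | .inr (.inr r) => .counter r) <| by
    rintro (_ | _ | _ | _ | l | r)
    exacts [⟨.inl 0, rfl⟩, ⟨.inl 1, rfl⟩, ⟨.inl 2, rfl⟩, ⟨.inl 3, rfl⟩, ⟨.inr (.inl l), rfl⟩,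
      ⟨.inr (.inr r), rfl⟩]

instance {R : Type*} [Finite R] : Finite (Msg R) :=
  Finite.of_surjective (α := Fin 3 ⊕ R ⊕ R ⊕ R)
    (fun | .inl i => ![.start, .reset, .done] i
         | .inr (.inl r) => .inc r
         | .inr (.inr (.inl r)) => .dec r
         | .inr (.inr (.inr r)) => .zero r) <| by
    rintro (_ | _ | _ | r | r | r)
    exacts [⟨.inl 0, rfl⟩, ⟨.inl 1, rfl⟩, ⟨.inl 2, rfl⟩, ⟨.inr (.inl r), rfl⟩,
      ⟨.inr (.inr (.inl r)), rfl⟩, ⟨.inr (.inr (.inr r)), rfl⟩]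

section Count

variable {L R : Type*} [DecidableEq L] [DecidableEq R] {n : ℕ} {e : Fin n} {x : St L R}
  {C C' : Config (St L R) n}

/-- The number of processes in a state. -/
def count (C : Config (St L R) n) (x : St L R) : ℕ := (Finset.univ.filter (C · = x)).card

theorem count_pos_iff : 0 < count C x ↔ ∃ e, C e = x := by
  simp [count, Finset.card_pos, Finset.filter_nonempty_iff]

theorem count_change (h : ∀ e' ≠ e, C' e' = x ↔ C e' = x) :
    count C' x + (if C e = x then 1 else 0) = count C x + (if C' e = x then 1 else 0) := by
  have key : ∀ D : Config (St L R) n, count D x =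
      (if D e = x then 1 else 0) + ∑ e' ∈ Finset.univ.erase e, if D e' = x then 1 else 0 := by
    intro D
    rw [Finset.add_sum_erase _ (fun e' => if D e' = x then 1 else 0) (Finset.mem_univ e), count,
      Finset.card_filter]
  have : ∑ e' ∈ Finset.univ.erase e, (if C' e' = x then 1 else 0) =
      ∑ e' ∈ Finset.univ.erase e, if C e' = x then 1 else 0 :=
    Finset.sum_congr rfl fun e' he => by simp only [h e' (Finset.ne_of_mem_erase he)]
  rw [key C, key C', this]
  omega

end Count

section Machine

variable {L R : Type*} [DecidableEq R]

/-- The state of a leader with the given instruction after a process has entered the counter `r`. -/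
def Instr.afterInc : Instr L R → R → St L R
  | .inc r' l, r => if r' = r then .leader l else .dead
  | _, _ => .dead

/-- The state of a leader with the given instruction after a process has left the counter `r`. -/
def Instr.afterDec : Instr L R → R → St L R
  | .dec r' _ l, r => if r' = r then .leader l else .dead
  | _, _ => .dead

/-- Reception is deterministic: the state that a message leads to, if it can be received. A leader
dies of a change of a counter that does not fit its instruction, and a process that represents a
unit of a counter dies of the claim that this counter is zero. -/
def recv (I : L → Instr L R) : St L R → Msg R → Option (St L R)
  | .init, .start => some .pool
  | .leader l, .inc r => some ((I l).afterInc r)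
  | .leader l, .dec r => some ((I l).afterDec r)
  | .counter r, .zero r' => if r = r' then some .dead else none
  | .counter _, .reset => some .pool
  | .counter _, .done => some .final
  | .pool, .done => some .final
  | _, _ => none

/-- The broadcast transitions. A leader whose machine has stopped can start the machine again or
finish the run. -/
inductive Bcast (I : L → Instr L R) (l₀ : L) : St L R → Msg R → St L R → Prop
  | elect : Bcast I l₀ .init .start (.leader l₀)
  | push (r : R) : Bcast I l₀ .pool (.inc r) (.counter r)
  | pop (r : R) : Bcast I l₀ (.counter r) (.dec r) .pool
  | zero {l r l' l''} : I l = .dec r l' l'' → Bcast I l₀ (.leader l) (.zero r) (.leader l')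
  | reset {l} : I l = .halt → Bcast I l₀ (.leader l) .reset (.leader l₀)
  | done {l} : I l = .halt → Bcast I l₀ (.leader l) .done .final

variable [Finite L] [Finite R]

/-- The protocol of the counter machine `I` with starting state `l₀`. -/
def machineProtocol (I : L → Instr L R) (l₀ : L) : Protocol (St L R) (Msg R) where
  init := .init
  trans := {t | match t with
    | (q, .broadcast a, q') => Bcast I l₀ q a q'
    | (q, .receive a, q') => recv I q a = some q'}

variable {I : L → Instr L R} {l₀ : L} {n : ℕ} {e₀ e : Fin n} {C C' : Config (St L R) n}
  {q q' : St L R} {a : Msg R} {l : L} {v : R → ℕ}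

theorem stepBy_iff : (machineProtocol I l₀).StepBy e q a q' C C' ↔
    Bcast I l₀ q a q' ∧ C e = q ∧ C' e = q' ∧
      ∀ e', e' ≠ e → C' e' = (recv I (C e') a).getD (C e') := by
  refine and_congr Iff.rfl (and_congr Iff.rfl (and_congr Iff.rfl (forall₂_congr fun e' _ => ?_)))
  have h : ∀ s, (C e', Op.receive a, s) ∈ (machineProtocol I l₀).trans ↔
      recv I (C e') a = some s := fun s => Iff.rfl
  simp only [Protocol.receivable, Set.mem_ofPred_eq, h]
  cases recv I (C e') a <;> simp [eq_comm]

/-- The configuration after the process `e` has broadcast `a` and entered the state `q'`. -/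
def after (I : L → Instr L R) (C : Config (St L R) n) (e : Fin n) (a : Msg R) (q' : St L R) :
    Config (St L R) n :=
  fun e' => if e' = e then q' else (recv I (C e') a).getD (C e')

theorem stepBy_after (h : Bcast I l₀ q a q') (hq : C e = q) :
    (machineProtocol I l₀).StepBy e q a q' C (after I C e a q') :=
  stepBy_iff.2 ⟨h, hq, if_pos rfl, fun _ h => if_neg h⟩

/-- Dead processes stay dead. -/
theorem eq_dead_of_step (h : (machineProtocol I l₀).Step C C') (he : C e = .dead) :
    C' e = .dead := by
  obtain ⟨e', q, a, q', h⟩ := h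
  obtain ⟨hb, hq, -, h⟩ := stepBy_iff.1 h
  have : e ≠ e' := by
    rintro rfl
    rw [he] at hq
    subst hq
    cases hb
  rw [h e this, he]
  cases a <;> rfl

variable [DecidableEq L]

/-- The configuration `C` with leader `e₀` represents the machine configuration `(l, v)`. Apart from
the processes that represent it and those in the pool there may be dead or final ones. -/
structure Represents (e₀ : Fin n) (C : Config (St L R) n) (l : L) (v : R → ℕ) : Prop where
  leader : C e₀ = .leader l
  other : ∀ e ≠ e₀, C e ≠ .init ∧ ∀ l, C e ≠ .leader l
  count_eq : ∀ r, count C (.counter r) = v r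

/-- Unless a process dies or the machine has stopped, a step of the protocol simulates a step of the
machine. -/
theorem Represents.step (hC : Represents e₀ C l v) (h : (machineProtocol I l₀).Step C C') :
    (∃ e, C e ≠ .dead ∧ C' e = .dead) ∨ I l = .halt ∨
      ∃ l' v', Represents e₀ C' l' v' ∧ (Halts I l' v' → Halts I l v) := by
  obtain ⟨e, q, a, q', h⟩ := h
  obtain ⟨hb, rfl, rfl, hs⟩ := stepBy_iff.1 h
  clear h
  obtain ⟨hl, ho, hv⟩ := hC
  generalize hq : C e = q at hb
  generalize hq' : C' e = q' at hb
  have hl_inj : ∀ {m}, C e = .leader m → e = e₀ ∧ m = l := by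
    intro m hm
    have he : e = e₀ := by_contra fun he => (ho e he).2 m hm
    subst he
    rw [hl] at hm
    cases hm
    exact ⟨rfl, rfl⟩
  cases hb with
  | elect =>
    by_cases he : e = e₀
    · subst he
      simp [hl] at hq
    · exact absurd hq (ho e he).1
  | push r =>
    have he : e₀ ≠ e := by rintro rfl; simp [hl] at hq
    have h0 := hs e₀ he
    have h1 : ∀ e' ≠ e, e' ≠ e₀ → C' e' = C e' := fun e' he' he₀ => by
      rw [hs e' he']
      have := ho e' he₀
      generalize C e' = s at this ⊢
      cases s <;> simp_all [recv]
    rw [hl] at h0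
    simp only [recv, Option.getD_some] at h0
    cases hi : I l with
    | halt => simp
    | dec => exact Or.inl ⟨e₀, by simp [hl], by rw [h0, hi]; rfl⟩
    | inc r' l' =>
      rw [hi, Instr.afterInc] at h0
      split_ifs at h0 with hr
      swap
      · exact Or.inl ⟨e₀, by simp [hl], h0⟩
      subst hr
      refine Or.inr (Or.inr ⟨l', Function.update v r' (v r' + 1), ⟨h0, fun e' he' => ?_,
        fun x => ?_⟩, fun ⟨w, hw⟩ => ⟨w, .inc hi hw⟩⟩)
      · by_cases hee : e' = e
        · subst hee; simp [hq']
        · rw [h1 e' hee he']; exact ho e' he'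
      · have := count_change (C := C) (C' := C') (e := e) (x := .counter x) fun e' hee => by
          by_cases he' : e' = e₀
          · subst he'; simp [hl, h0]
          · rw [h1 e' hee he']
        rw [hv, hq, hq'] at this
        simp only [Function.update_apply]
        grind
  | pop r =>
    have he : e₀ ≠ e := by rintro rfl; simp [hl] at hq
    have h0 := hs e₀ he
    have h1 : ∀ e' ≠ e, e' ≠ e₀ → C' e' = C e' := fun e' he' he₀ => by
      rw [hs e' he']
      have := ho e' he₀
      generalize C e' = s at this ⊢
      cases s <;> simp_all [recv]
    rw [hl] at h0
    simp only [recv, Option.getD_some] at h0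
    cases hi : I l with
    | halt => simp
    | inc => exact Or.inl ⟨e₀, by simp [hl], by rw [h0, hi]; rfl⟩
    | dec r' l₁ l' =>
      rw [hi, Instr.afterDec] at h0
      split_ifs at h0 with hr
      swap
      · exact Or.inl ⟨e₀, by simp [hl], h0⟩
      subst hr
      have hpos : 0 < v r' := by rw [← hv]; exact count_pos_iff.2 ⟨e, hq⟩
      refine Or.inr (Or.inr ⟨l', Function.update v r' (v r' - 1), ⟨h0, fun e' he' => ?_,
        fun x => ?_⟩, fun ⟨w, hw⟩ => ⟨w, .pos hi hpos.ne' hw⟩⟩)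
      · by_cases hee : e' = e
        · subst hee; simp [hq']
        · rw [h1 e' hee he']; exact ho e' he'
      · have := count_change (C := C) (C' := C') (e := e) (x := .counter x) fun e' hee => by
          by_cases he' : e' = e₀
          · subst he'; simp [hl, h0]
          · rw [h1 e' hee he']
        rw [hv, hq, hq'] at this
        simp only [Function.update_apply]
        grind
  | @zero m r l' l'' hi =>
    obtain ⟨rfl, rfl⟩ := hl_inj hq
    by_cases hr : v r = 0
    · have h1 : ∀ e' ≠ e, C' e' = C e' := fun e' he' => by
        have hne : C e' ≠ .counter r := fun hc => by
          have := count_pos_iff.2 ⟨e', hc⟩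
          rw [hv, hr] at this
          exact this.false
        rw [hs e' he']
        have := ho e' he'
        generalize C e' = s at this hne ⊢
        cases s <;> simp_all [recv]
      refine Or.inr (Or.inr ⟨l', v, ⟨hq', fun e' he' => h1 e' he' ▸ ho e' he', fun x => ?_⟩,
        fun ⟨w, hw⟩ => ⟨w, .zero hi hr hw⟩⟩)
      have := count_change (C := C) (C' := C') (e := e) (x := .counter x)
        fun e' hee => by rw [h1 e' hee]
      rw [hv, hq, hq'] at this
      simpa using this
    · obtain ⟨e', he'⟩ := count_pos_iff.1 (Nat.pos_of_ne_zero (hv r ▸ hr))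
      have hee : e' ≠ e := by rintro rfl; simp [he'] at hq
      exact Or.inl ⟨e', by simp [he'], by rw [hs e' hee, he']; simp [recv]⟩
  | @reset m hi => exact Or.inr (Or.inl ((hl_inj hq).2 ▸ hi))
  | @done m hi => exact Or.inr (Or.inl ((hl_inj hq).2 ▸ hi))

end Machine

/-! ### The two problems for the protocol of a counter machine -/

section StartConfig

variable {L R : Type*} {n : ℕ}

/-- The configuration with leader `e₀` in the starting state and all other processes in the pool. -/
def startConfig (l₀ : L) (e₀ : Fin n) : Config (St L R) n :=
  fun e => if e = e₀ then .leader l₀ else .pool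

variable [DecidableEq L] [DecidableEq R]

theorem represents_startConfig (l₀ : L) (e₀ : Fin n) :
    Represents e₀ (startConfig l₀ e₀ : Config (St L R) n) l₀ 0 := by
  refine ⟨by simp [startConfig], fun e he => by simp [startConfig, he], fun r => ?_⟩
  by_contra h
  obtain ⟨e, he⟩ := count_pos_iff.1 (Nat.pos_of_ne_zero h)
  simp only [startConfig] at he
  split_ifs at he

/-- `Faithful e₀ C l v`: the configuration `C` represents `(l, v)`, and no process is dead or
final. -/
structure Faithful (e₀ : Fin n) (C : Config (St L R) n) (l : L) (v : R → ℕ) : Prop where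
  leader : C e₀ = .leader l
  other : ∀ e ≠ e₀, C e = .pool ∨ ∃ r, C e = .counter r
  count_eq : ∀ r, count C (.counter r) = v r

theorem faithful_startConfig (l₀ : L) (e₀ : Fin n) :
    Faithful e₀ (startConfig l₀ e₀ : Config (St L R) n) l₀ 0 where
  leader := (represents_startConfig l₀ e₀).leader
  other e he := by simp [startConfig, he]
  count_eq := (represents_startConfig l₀ e₀).count_eq

end StartConfig

section Machine

variable {L R : Type*} [DecidableEq R] [Finite L] [Finite R]
  {I : L → Instr L R} {l₀ : L} {n : ℕ} {e₀ e : Fin n} {C C' : Config (St L R) n}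
  {q q' : St L R} {a : Msg R} {l : L} {v v' : R → ℕ}

/-- The first step of an execution elects a leader. -/
theorem step_of_isInitial (hC : (machineProtocol I l₀).IsInitial C)
    (h : (machineProtocol I l₀).Step C C') : ∃ e₀, C' = startConfig l₀ e₀ := by
  obtain ⟨e, q, a, q', h⟩ := h
  obtain ⟨hb, rfl, he, hs⟩ := stepBy_iff.1 h
  have hC : ∀ e, C e = .init := hC
  rw [hC] at hb
  cases hb
  refine ⟨e, funext fun e' => ?_⟩
  by_cases h' : e' = e
  · subst h'; simp [startConfig, he]
  · simp [startConfig, h', hs e' h', hC, recv]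

theorem step_startConfig (hC : (machineProtocol I l₀).IsInitial C) (e₀ : Fin n) :
    (machineProtocol I l₀).Step C (startConfig l₀ e₀) := by
  have hC : ∀ e, C e = .init := hC
  refine ⟨e₀, .init, .start, .leader l₀, stepBy_iff.2 ⟨.elect, hC e₀, by simp [startConfig], ?_⟩⟩
  intro e' he'
  simp [startConfig, he', hC, recv]

/-- If all processes but `e₀` have lost the election, then none of them becomes a leader. -/
theorem forall_ne_leader_of_step (h : (machineProtocol I l₀).Step C C')
    (hC : ∀ e, C e ≠ .init ∧ (e ≠ e₀ → ∀ l, C e ≠ .leader l)) :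
    ∀ e, C' e ≠ .init ∧ (e ≠ e₀ → ∀ l, C' e ≠ .leader l) := by
  obtain ⟨e, q, a, q', h⟩ := h
  obtain ⟨hb, hq, hq', hs⟩ := stepBy_iff.1 h
  intro e'
  have := hC e'
  by_cases he' : e' = e
  · subst he'
    rw [hq] at this
    rw [hq']
    cases hb <;> simp_all
  · rw [hs e' he']
    generalize C e' = s at this ⊢
    cases s <;> cases a <;> simp_all [recv]
    · cases I _ <;> grind [Instr.afterInc]
    · cases I _ <;> grind [Instr.afterDec]
    · grind

variable [DecidableEq L]

/-- If an execution ends with all processes in the final state, then none has died and the machine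
has been simulated faithfully. -/
theorem halts_of_reaches_final (h : Relation.ReflTransGen (machineProtocol I l₀).Step C C')
    (hf : ∀ e, C' e = .final) (hC : Represents e₀ C l v) : Halts I l v := by
  have hdead : ∀ {D}, Relation.ReflTransGen (machineProtocol I l₀).Step D C' →
      ∀ e, D e ≠ .dead := by
    intro D hD
    induction hD using Relation.ReflTransGen.head_induction_on with
    | refl => simp [hf]
    | head h _ ih => exact fun e he => ih e (eq_dead_of_step h he)
  induction h using Relation.ReflTransGen.head_induction_on generalizing l v with
  | refl =>
    have := hC.leader
    simp [hf] at this
  | head h h' ih =>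
    obtain ⟨e, -, he⟩ | hi | ⟨l', v', hC', himp⟩ := hC.step h
    · exact absurd he (hdead h' e)
    · exact ⟨v, .halt hi⟩
    · exact himp (ih hC')

/-- A halting computation can be simulated faithfully if the pool is large enough. -/
theorem exists_reaches_of_eval (h : Eval I l v v') : ∃ N, ∀ (n : ℕ) (e₀ : Fin n) C,
    Faithful e₀ C l v → N ≤ count C .pool → ∃ C' l',
      Relation.ReflTransGen (machineProtocol I l₀).Step C C' ∧ Faithful e₀ C' l' v' ∧
        I l' = .halt := by
  induction h with
  | @halt l v hi => exact ⟨0, fun n e₀ C hC _ => ⟨C, l, .refl, hC, hi⟩⟩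
  | @inc l v v' r l' hi _ ih =>
    obtain ⟨N, ih⟩ := ih
    refine ⟨N + 1, fun n e₀ C hC hN => ?_⟩
    obtain ⟨e, he⟩ := count_pos_iff.1 (N.succ_pos.trans_le hN)
    have he₀ : e₀ ≠ e := by rintro rfl; simp [hC.leader] at he
    have hstep := stepBy_after (I := I) (l₀ := l₀) (.push r) he
    set C₁ := after I C e (.inc r) (.counter r) with hC₁
    have h1 : C₁ e = .counter r := if_pos rfl
    have h0 : C₁ e₀ = .leader l' := by simp [hC₁, after, he₀, hC.leader, recv, hi, Instr.afterInc]
    have h2 : ∀ e' ≠ e, e' ≠ e₀ → C₁ e' = C e' := fun e' he' he'₀ => by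
      obtain h | ⟨r', h⟩ := hC.other e' he'₀ <;> simp [hC₁, after, he', h, recv]
    have h3 := fun (x : St L R) (hx : ∀ l, .leader l ≠ x) =>
      count_change (C := C) (C' := C₁) (e := e) (x := x) fun e' hee => by
        by_cases he' : e' = e₀
        · subst he'; simp [hC.leader, h0, hx]
        · rw [h2 e' hee he']
    have hrep : Faithful e₀ C₁ l' (Function.update v r (v r + 1)) := by
      refine ⟨h0, fun e' he' => ?_, fun x => ?_⟩
      · by_cases hee : e' = e
        · subst hee; simp [h1]
        · rw [h2 e' hee he']; exact hC.other e' he'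
      · have := h3 (.counter x) (by simp)
        rw [hC.count_eq, he, h1] at this
        simp only [Function.update_apply]
        grind
    have hN' : N ≤ count C₁ .pool := by
      have := h3 .pool (by simp)
      rw [he, h1] at this
      grind
    obtain ⟨C', m, hr, hC'⟩ := ih n e₀ C₁ hrep hN'
    exact ⟨C', m, .head ⟨_, _, _, _, hstep⟩ hr, hC'⟩
  | @zero l v v' r l' l'' hi hz _ ih =>
    obtain ⟨N, ih⟩ := ih
    refine ⟨N, fun n e₀ C hC hN => ?_⟩
    have hstep := stepBy_after (I := I) (l₀ := l₀) (.zero hi) hC.leader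
    set C₁ := after I C e₀ (.zero r) (.leader l') with hC₁
    have h0 : C₁ e₀ = .leader l' := if_pos rfl
    have h2 : ∀ e' ≠ e₀, C₁ e' = C e' := fun e' he' => by
      obtain h | ⟨r', h⟩ := hC.other e' he'
      · simp [hC₁, after, he', h, recv]
      · have : r' ≠ r := by
          rintro rfl
          have := count_pos_iff.2 ⟨e', h⟩
          rw [hC.count_eq, hz] at this
          exact this.false
        simp [hC₁, after, he', h, recv, this]
    have h3 := fun (x : St L R) (hx : ∀ l, .leader l ≠ x) => by
      have := count_change (C := C) (C' := C₁) (e := e₀) (x := x) fun e' hee => by rw [h2 e' hee]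
      simpa only [hC.leader, h0, hx, if_false, Nat.add_zero] using this
    obtain ⟨C', m, hr, hC'⟩ := ih n e₀ C₁ ⟨h0, fun e' he' => h2 e' he' ▸ hC.other e' he',
      fun x => (h3 _ (by simp)).trans (hC.count_eq x)⟩ (hN.trans_eq (h3 _ (by simp)).symm)
    exact ⟨C', m, .head ⟨_, _, _, _, hstep⟩ hr, hC'⟩
  | @pos l v v' r l' l'' hi hz _ ih =>
    obtain ⟨N, ih⟩ := ih
    refine ⟨N, fun n e₀ C hC hN => ?_⟩
    obtain ⟨e, he⟩ := count_pos_iff.1 ((Nat.pos_of_ne_zero hz).trans_eq (hC.count_eq r).symm)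
    have he₀ : e₀ ≠ e := by rintro rfl; simp [hC.leader] at he
    have hstep := stepBy_after (I := I) (l₀ := l₀) (.pop r) he
    set C₁ := after I C e (.dec r) .pool with hC₁
    have h1 : C₁ e = .pool := if_pos rfl
    have h0 : C₁ e₀ = .leader l'' := by
      simp [hC₁, after, he₀, hC.leader, recv, hi, Instr.afterDec]
    have h2 : ∀ e' ≠ e, e' ≠ e₀ → C₁ e' = C e' := fun e' he' he'₀ => by
      obtain h | ⟨r', h⟩ := hC.other e' he'₀ <;> simp [hC₁, after, he', h, recv]
    have h3 := fun (x : St L R) (hx : ∀ l, .leader l ≠ x) =>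
      count_change (C := C) (C' := C₁) (e := e) (x := x) fun e' hee => by
        by_cases he' : e' = e₀
        · subst he'; simp [hC.leader, h0, hx]
        · rw [h2 e' hee he']
    have hrep : Faithful e₀ C₁ l'' (Function.update v r (v r - 1)) := by
      refine ⟨h0, fun e' he' => ?_, fun x => ?_⟩
      · by_cases hee : e' = e
        · subst hee; simp [h1]
        · rw [h2 e' hee he']; exact hC.other e' he'
      · have := h3 (.counter x) (by simp)
        rw [hC.count_eq, he, h1] at this
        simp only [Function.update_apply]
        grind
    have hN' : N ≤ count C₁ .pool := by
      have := h3 .pool (by simp)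
      rw [he, h1] at this
      grind
    obtain ⟨C', m, hr, hC'⟩ := ih n e₀ C₁ hrep hN'
    exact ⟨C', m, .head ⟨_, _, _, _, hstep⟩ hr, hC'⟩

/-- If the machine halts, then sufficiently many processes can simulate it up to that point. -/
theorem exists_reaches_of_halts (h : Halts I l₀ 0) : ∃ (N : ℕ) (C : Config (St L R) (N + 1))
    (l : L) (v : R → ℕ), Relation.ReflTransGen (machineProtocol I l₀).Step (startConfig l₀ 0) C ∧
      Faithful 0 C l v ∧ I l = .halt := by
  obtain ⟨v, h⟩ := h
  obtain ⟨N, hN⟩ := exists_reaches_of_eval (l₀ := l₀) h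
  obtain ⟨C, l, hC⟩ := hN (N + 1) 0 (startConfig l₀ 0) (faithful_startConfig _ _) (by
    have : (Finset.univ.filter fun e : Fin (N + 1) => (startConfig l₀ 0 : Config (St L R) _) e =
        .pool) = Finset.univ.erase 0 := by
      ext e
      by_cases he : e = 0 <;> simp [startConfig, he]
    simp [count, this])
  exact ⟨N, C, l, v, hC⟩

/-- All processes can be synchronized in the final state if and only if the machine halts. -/
theorem synchronizes_iff : (machineProtocol I l₀).Synchronizes .final ↔ Halts I l₀ 0 := by
  constructor
  · rintro ⟨n, hn, C, C', hC, h, hf⟩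
    obtain rfl | ⟨C₁, hC₁, h⟩ := h.cases_head
    · have := (hC ⟨0, hn⟩).symm.trans (hf ⟨0, hn⟩)
      cases this
    · obtain ⟨e₀, rfl⟩ := step_of_isInitial hC hC₁
      exact halts_of_reaches_final h hf (represents_startConfig l₀ e₀)
  · intro h
    obtain ⟨N, C, l, v, hr, hC, hl⟩ := exists_reaches_of_halts h
    refine ⟨N + 1, N.succ_pos, fun _ => .init, after I C 0 .done .final, fun _ => rfl, ?_,
      fun e => ?_⟩
    · exact (Relation.ReflTransGen.head (step_startConfig (fun _ => rfl) 0) hr).tail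
        ⟨_, _, _, _, stepBy_after (.done hl) hC.leader⟩
    · by_cases he : e = 0
      · simp [after, he]
      · obtain h | ⟨r, h⟩ := hC.other e he <;> simp [after, he, h, recv]

/-- A path between two points as a sequence. -/
theorem exists_seq_of_reflTransGen {α : Type*} {r : α → α → Prop} {x y : α}
    (h : Relation.ReflTransGen r x y) :
    ∃ (p : ℕ → α) (m : ℕ), p 0 = x ∧ p m = y ∧ ∀ i < m, r (p i) (p (i + 1)) := by
  induction h with
  | refl => exact ⟨fun _ => x, 0, rfl, rfl, by simp⟩
  | @tail b c _ hbc ih =>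
    obtain ⟨p, m, h0, hm, hp⟩ := ih
    refine ⟨fun i => if i ≤ m then p i else c, m + 1, by simp [h0], by simp, fun i hi => ?_⟩
    obtain hi | rfl := Nat.lt_succ_iff_lt_or_eq.1 hi
    · simpa [hi.le, Nat.succ_le_of_lt hi] using hp i hi
    · simpa [hm] using hbc

/-- A leader that restarts the machine infinitely often halts it infinitely often; as only finitely
many processes can die, one of the simulations in between is faithful. -/
theorem halts_of_repeatedlyCovers {h : L} (hh : I h = .halt)
    (H : (machineProtocol I l₀).RepeatedlyCovers (.leader h) .reset (.leader l₀)) :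
    Halts I l₀ 0 := by
  obtain ⟨n, -, ρ, ⟨h0, hρ⟩, e₀, he₀⟩ := H
  -- The dead processes are the same from some time `m` on.
  obtain ⟨m, hm⟩ : ∃ m, ∀ k ≥ m, ∀ e, ρ k e = .dead → ρ m e = .dead := by
    let D : ℕ →o Finset (Fin n) := ⟨fun k => Finset.univ.filter (ρ k · = .dead),
      monotone_nat_of_le_succ fun k e => by simpa using eq_dead_of_step (hρ k)⟩
    obtain ⟨m, hm⟩ := WellFoundedGT.monotone_chain_condition D
    refine ⟨m, fun k hk e he => ?_⟩
    have : e ∈ D k := by simpa [D] using he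
    rw [← hm k hk] at this
    simpa [D] using this
  have hmono : ∀ e k, m ≤ k → ρ m e = .dead → ρ k e = .dead := fun e k hk hd => by
    induction k, hk using Nat.le_induction with
    | base => exact hd
    | succ k _ ih => exact eq_dead_of_step (hρ k) ih
  obtain ⟨e₁, h1⟩ := step_of_isInitial h0 (hρ 0)
  have hlead : ∀ k, ∀ e, ρ (k + 1) e ≠ .init ∧ (e ≠ e₁ → ∀ l, ρ (k + 1) e ≠ .leader l) := by
    intro k
    induction k with
    | zero =>
      intro e
      by_cases he : e = e₁ <;> simp [h1, startConfig, he]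
    | succ k ih => exact forall_ne_leader_of_step (hρ (k + 1)) ih
  have hlead_eq : ∀ k e l, ρ (k + 1) e = .leader l → e = e₁ := fun k e l he =>
    by_contra fun hne => (hlead k e).2 hne l he
  obtain ⟨j, hj, hs⟩ := he₀ m
  obtain ⟨-, hq, hq', hs⟩ := stepBy_iff.1 hs
  obtain ⟨j, rfl⟩ : ∃ i, j = i + 1 := ⟨j - 1, by omega⟩
  obtain rfl := hlead_eq j e₀ h hq
  have hrep : Represents e₀ (ρ (j + 1 + 1)) l₀ 0 := by
    refine ⟨hq', fun e he => ⟨(hlead _ e).1, (hlead _ e).2 he⟩, fun r => ?_⟩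
    by_contra hne
    obtain ⟨e, he⟩ := count_pos_iff.1 (Nat.pos_of_ne_zero hne)
    have hee : e ≠ e₀ := by rintro rfl; simp [hq'] at he
    rw [hs e hee] at he
    have := (hlead j e).2 hee
    generalize ρ (j + 1) e = s at this he
    cases s <;> simp_all [recv]
  -- From here on the simulation is faithful as long as the machine has not halted.
  have hsim : ∀ k, Halts I l₀ 0 ∨ ∃ l v, Represents e₀ (ρ (j + 1 + 1 + k)) l v ∧
      (Halts I l v → Halts I l₀ 0) := by
    intro k
    induction k with
    | zero => exact Or.inr ⟨l₀, 0, hrep, id⟩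
    | succ k ih =>
      obtain ih | ⟨l, v, hr, himp⟩ := ih
      · exact Or.inl ih
      obtain ⟨e, he, he'⟩ | hi | ⟨l', v', hr', himp'⟩ := hr.step (hρ _)
      · exact absurd (hmono e _ (by omega) (hm _ (by omega) e he')) he
      · exact Or.inl (himp ⟨v, .halt hi⟩)
      · exact Or.inr ⟨l', v', hr', fun h => himp (himp' h)⟩
  obtain ⟨i, hi, hs⟩ := he₀ (j + 1 + 1)
  obtain ⟨k, rfl⟩ := Nat.exists_eq_add_of_lt hi
  obtain hsim | ⟨l, v, hr, himp⟩ := hsim (k + 1)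
  · exact hsim
  · have := hr.leader.symm.trans (stepBy_iff.1 hs).2.1
    cases this
    exact himp ⟨v, .halt hh⟩

/-- The leader can restart the machine infinitely often if and only if the machine halts. -/
theorem repeatedlyCovers_iff {h : L} (hh : ∀ l, I l = .halt ↔ l = h) :
    (machineProtocol I l₀).RepeatedlyCovers (.leader h) .reset (.leader l₀) ↔ Halts I l₀ 0 := by
  refine ⟨halts_of_repeatedlyCovers ((hh h).2 rfl), fun H => ?_⟩
  obtain ⟨N, C, l, v, hr, hC, hl⟩ := exists_reaches_of_halts H
  obtain rfl := (hh l).1 hl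
  have hreset : (machineProtocol I l₀).StepBy 0 (.leader l) .reset (.leader l₀) C
      (startConfig l₀ 0) := by
    refine stepBy_iff.2 ⟨.reset hl, hC.leader, by simp [startConfig], fun e he => ?_⟩
    obtain h | ⟨r, h⟩ := hC.other e he <;> simp [startConfig, he, h, recv]
  obtain ⟨p, m, hp0, hpm, hp⟩ := exists_seq_of_reflTransGen hr
  -- The execution runs through the cycle `p 0 → ⋯ → p m → p 0`.
  let ρ : ℕ → Config (St L R) (N + 1) := fun
    | 0 => fun _ => .init
    | i + 1 => p (i % (m + 1))
  have hmod : ∀ i, i % (m + 1) = m → (i + 1) % (m + 1) = 0 := fun i hi => by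
    rw [← Nat.mod_add_mod, hi, Nat.mod_self]
  refine ⟨N + 1, N.succ_pos, ρ, ⟨fun _ => rfl, fun i => ?_⟩, 0, fun i => ?_⟩
  · cases i with
    | zero =>
      change (machineProtocol I l₀).Step _ (p (0 % (m + 1)))
      rw [Nat.zero_mod, hp0]
      exact step_startConfig (fun _ => rfl) 0
    | succ i =>
      change (machineProtocol I l₀).Step (p (i % (m + 1))) (p ((i + 1) % (m + 1)))
      by_cases hi : i % (m + 1) = m
      · rw [hmod i hi, hi, hpm, hp0]
        exact ⟨_, _, _, _, hreset⟩
      · have hlt : i % (m + 1) < m := by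
          have : i % (m + 1) < m + 1 := Nat.mod_lt i m.succ_pos
          omega
        have : (i + 1) % (m + 1) = i % (m + 1) + 1 := by
          rw [← Nat.mod_add_mod, Nat.mod_eq_of_lt (by omega)]
        rw [this]
        exact hp _ hlt
  · refine ⟨i * (m + 1) + m + 1, by nlinarith, ?_⟩
    have hi : (i * (m + 1) + m) % (m + 1) = m := by
      rw [Nat.mul_add_mod_self_right, Nat.mod_eq_of_lt m.lt_succ_self]
    change (machineProtocol I l₀).StepBy _ _ _ _ (p ((i * (m + 1) + m) % (m + 1)))
      (p ((i * (m + 1) + m + 1) % (m + 1)))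
    rw [hmod _ hi, hi, hpm, hp0]
    exact hreset

end Machine

/-! ### Isomorphic protocols -/

@[simp] theorem Op.map_broadcast {M M' : Type*} (f : M → M') (a : M) :
    (Op.broadcast a).map f = .broadcast (f a) := rfl

@[simp] theorem Op.map_receive {M M' : Type*} (f : M → M') (a : M) :
    (Op.receive a).map f = .receive (f a) := rfl

theorem Op.map_map {M M' M'' : Type*} (f : M → M') (g : M' → M'') (o : Op M) :
    (o.map f).map g = o.map (g ∘ f) := by
  cases o <;> rfl

namespace Protocol

/-- A renaming of states and messages that turns one protocol into another. -/
structure Iso {Q M Q' M' : Type*} [Finite Q] [Finite M] [Finite Q'] [Finite M']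
    (P : Protocol Q M) (P' : Protocol Q' M') where
  /-- The renaming of states. -/
  states : Q ≃ Q'
  /-- The renaming of messages. -/
  msgs : M ≃ M'
  init_eq : states P.init = P'.init
  mem_iff : ∀ q o q', (states q, o.map msgs, states q') ∈ P'.trans ↔ (q, o, q') ∈ P.trans

namespace Iso

variable {Q M Q' M' : Type*} [Finite Q] [Finite M] [Finite Q'] [Finite M']
  {P : Protocol Q M} {P' : Protocol Q' M'}

/-- The inverse renaming. -/
def symm (i : P.Iso P') : P'.Iso P where
  states := i.states.symm
  msgs := i.msgs.symm
  init_eq := by simp [← i.init_eq]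
  mem_iff q o q' := by
    rw [← i.mem_iff, Op.map_map]
    cases o <;> simp

theorem stepBy (i : P.Iso P') {n : ℕ} {e : Fin n} {q q' : Q} {a : M} {C C' : Config Q n}
    (h : P.StepBy e q a q' C C') :
    P'.StepBy e (i.states q) (i.msgs a) (i.states q') (i.states ∘ C) (i.states ∘ C') := by
  obtain ⟨ht, hq, hq', h⟩ := h
  refine ⟨(i.mem_iff _ _ _).2 ht, by simp [hq], by simp [hq'], fun e' he' => ?_⟩
  obtain h | ⟨hr, h⟩ := h e' he'
  · exact Or.inl ((i.mem_iff _ _ _).2 h)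
  · refine Or.inr ⟨fun ⟨p, hp⟩ => hr ⟨i.states.symm p, ?_⟩, by simp [h]⟩
    rw [← i.mem_iff]
    simpa using hp

theorem step (i : P.Iso P') {n : ℕ} {C C' : Config Q n} (h : P.Step C C') :
    P'.Step (i.states ∘ C) (i.states ∘ C') := by
  obtain ⟨e, q, a, q', h⟩ := h
  exact ⟨e, _, _, _, i.stepBy h⟩

theorem isInitial (i : P.Iso P') {n : ℕ} {C : Config Q n} (h : P.IsInitial C) :
    P'.IsInitial (i.states ∘ C) := fun e => by simp [h e, i.init_eq]

theorem synchronizes (i : P.Iso P') {q : Q} (h : P.Synchronizes q) :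
    P'.Synchronizes (i.states q) := by
  obtain ⟨n, hn, C, C', hC, h, hq⟩ := h
  exact ⟨n, hn, i.states ∘ C, i.states ∘ C', i.isInitial hC,
    Relation.ReflTransGen.lift (fun D : Config Q n => i.states ∘ D) (fun _ _ => i.step) _ _ h,
    fun e => by simp [hq e]⟩

theorem repeatedlyCovers (i : P.Iso P') {q q' : Q} {a : M} (h : P.RepeatedlyCovers q a q') :
    P'.RepeatedlyCovers (i.states q) (i.msgs a) (i.states q') := by
  obtain ⟨n, hn, ρ, ⟨h0, hρ⟩, e, he⟩ := h
  refine ⟨n, hn, fun k => i.states ∘ ρ k, ⟨i.isInitial h0, fun k => i.step (hρ k)⟩, e, fun k => ?_⟩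
  obtain ⟨j, hj, h⟩ := he k
  exact ⟨j, hj, i.stepBy h⟩

theorem synchronizes_iff (i : P.Iso P') {q : Q} :
    P'.Synchronizes (i.states q) ↔ P.Synchronizes q :=
  ⟨fun h => by simpa [symm] using i.symm.synchronizes h, i.synchronizes⟩

theorem repeatedlyCovers_iff (i : P.Iso P') {q q' : Q} {a : M} :
    P'.RepeatedlyCovers (i.states q) (i.msgs a) (i.states q') ↔ P.RepeatedlyCovers q a q' :=
  ⟨fun h => by simpa [symm] using i.symm.repeatedlyCovers h, i.repeatedlyCovers⟩

end Iso

end Protocol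

/-! ### The finite presentation of the protocol -/

/-- The number of a state if there are `B` counters. -/
def St.num (B : ℕ) : St ℕ ℕ → ℕ
  | .init => 0
  | .pool => 1
  | .dead => 2
  | .final => 3
  | .counter r => 4 + r
  | .leader l => 4 + B + l

/-- The number of a message if there are `B` counters. -/
def Msg.num (B : ℕ) : Msg ℕ → ℕ
  | .start => 0
  | .reset => 1
  | .done => 2
  | .inc r => 3 + r
  | .dec r => 3 + B + r
  | .zero r => 3 + 2 * B + r

/-- Renaming of control states and counters in a state. -/
def St.map {L R L' R' : Type*} (f : L → L') (g : R → R') : St L R → St L' R'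
  | .init => .init
  | .pool => .pool
  | .dead => .dead
  | .final => .final
  | .counter r => .counter (g r)
  | .leader l => .leader (f l)

/-- Renaming of counters in a message. -/
def Msg.map {R R' : Type*} (g : R → R') : Msg R → Msg R'
  | .start => .start
  | .reset => .reset
  | .done => .done
  | .inc r => .inc (g r)
  | .dec r => .dec (g r)
  | .zero r => .zero (g r)

/-- The numbering of states with `N` control states and `B` counters. -/
noncomputable def stEquiv (N B : ℕ) : St (Fin N) (Fin B) ≃ Fin (4 + B + N) :=
  Equiv.ofBijective (fun q => ⟨(q.map Fin.val Fin.val).num B, by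
    cases q <;> simp only [St.map, St.num] <;> omega⟩) <| by
  constructor
  · intro q q' h
    simp only [Fin.mk.injEq] at h
    cases q <;> cases q' <;> simp only [St.map, St.num] at h <;> first | rfl | omega | skip
    · simp only [St.leader.injEq]; omega
    · simp only [St.counter.injEq]; omega
  · intro ⟨k, hk⟩
    obtain rfl | rfl | rfl | rfl | h | h : k = 0 ∨ k = 1 ∨ k = 2 ∨ k = 3 ∨
      (4 ≤ k ∧ k < 4 + B) ∨ 4 + B ≤ k := by omega
    · exact ⟨.init, rfl⟩
    · exact ⟨.pool, rfl⟩
    · exact ⟨.dead, rfl⟩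
    · exact ⟨.final, rfl⟩
    · exact ⟨.counter ⟨k - 4, by omega⟩, Fin.ext (by simp only [St.map, St.num]; omega)⟩
    · exact ⟨.leader ⟨k - (4 + B), by omega⟩, Fin.ext (by simp only [St.map, St.num]; omega)⟩

/-- The numbering of messages with `B` counters. -/
noncomputable def msgEquiv (B : ℕ) : Msg (Fin B) ≃ Fin (3 + 3 * B) :=
  Equiv.ofBijective (fun a => ⟨(a.map Fin.val).num B, by
    cases a <;> simp only [Msg.map, Msg.num] <;> omega⟩) <| by
  constructor
  · intro a a' h
    simp only [Fin.mk.injEq] at h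
    cases a <;> cases a' <;> simp only [Msg.map, Msg.num] at h <;> first | rfl | omega | skip
    · simp only [Msg.inc.injEq]; omega
    · simp only [Msg.dec.injEq]; omega
    · simp only [Msg.zero.injEq]; omega
  · intro ⟨k, hk⟩
    obtain rfl | rfl | rfl | h | h | h : k = 0 ∨ k = 1 ∨ k = 2 ∨ (3 ≤ k ∧ k < 3 + B) ∨
      (3 + B ≤ k ∧ k < 3 + 2 * B) ∨ 3 + 2 * B ≤ k := by omega
    · exact ⟨.start, rfl⟩
    · exact ⟨.reset, rfl⟩
    · exact ⟨.done, rfl⟩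
    · exact ⟨.inc ⟨k - 3, by omega⟩, Fin.ext (by simp only [Msg.map, Msg.num]; omega)⟩
    · exact ⟨.dec ⟨k - (3 + B), by omega⟩, Fin.ext (by simp only [Msg.map, Msg.num]; omega)⟩
    · exact ⟨.zero ⟨k - (3 + 2 * B), by omega⟩, Fin.ext (by simp only [Msg.map, Msg.num]; omega)⟩

/-- The transitions of a leader in the control state `l` with the given instruction, except for the
restart. Here and below, states and messages are written as their numbers under `St.num B` and
`Msg.num B`. -/
def leaderTrans (B l : ℕ) (i : Instr ℕ ℕ) : List (ℕ × Op ℕ × ℕ) :=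
  (match i with
    | .halt => [(4 + B + l, .broadcast 2, 3)]
    | .inc _ _ => []
    | .dec r l' _ => [(4 + B + l, .broadcast (3 + 2 * B + r), 4 + B + l')]) ++
  (List.range B).flatMap fun r =>
    [(4 + B + l, .receive (3 + r), (i.afterInc r).num B),
      (4 + B + l, .receive (3 + B + r), (i.afterDec r).num B)]

/-- The transitions that start and restart the machine in the control state `s`, where `h` is the
halting control state. -/
def startTrans (B h s : ℕ) : List (ℕ × Op ℕ × ℕ) :=
  [(0, .broadcast 0, 4 + B + s), (4 + B + h, .broadcast 1, 4 + B + s)]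

/-- The remaining transitions. -/
def otherTrans (B : ℕ) : List (ℕ × Op ℕ × ℕ) :=
  [(0, .receive 0, 1), (1, .receive 2, 3)] ++
  (List.range B).flatMap fun r =>
    [(1, .broadcast (3 + r), 4 + r), (4 + r, .broadcast (3 + B + r), 1),
      (4 + r, .receive (3 + 2 * B + r), 2), (4 + r, .receive 1, 1), (4 + r, .receive 2, 3)]

/-- The list of transitions for the counter machine `I` with control states below `N`, starting
state `s`, halting state `h`, and counters below `B`. -/
def machineTrans (N B h s : ℕ) (I : ℕ → Instr ℕ ℕ) : List (ℕ × Op ℕ × ℕ) :=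
  startTrans B h s ++ (otherTrans B ++ (List.range N).flatMap fun l => leaderTrans B l (I l))

section Encoding

variable {N B : ℕ} {I : ℕ → Instr ℕ ℕ} {M : Fin N → Instr (Fin N) (Fin B)} {h s : Fin N}

theorem Instr.map_afterInc (i : Instr (Fin N) (Fin B)) (r : Fin B) :
    (i.afterInc r).map Fin.val Fin.val = (i.map Fin.val Fin.val).afterInc (r : ℕ) := by
  cases i <;> simp only [afterInc, map, Fin.val_inj] <;> first | rfl | (split_ifs <;> rfl)

theorem Instr.map_afterDec (i : Instr (Fin N) (Fin B)) (r : Fin B) :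
    (i.afterDec r).map Fin.val Fin.val = (i.map Fin.val Fin.val).afterDec (r : ℕ) := by
  cases i <;> simp only [afterDec, map, Fin.val_inj] <;> first | rfl | (split_ifs <;> rfl)

/-- The encoding of a transition. -/
def encTrans (t : St (Fin N) (Fin B) × Op (Msg (Fin B)) × St (Fin N) (Fin B)) : ℕ × Op ℕ × ℕ :=
  ((t.1.map Fin.val Fin.val).num B, t.2.1.map (fun a => (a.map Fin.val).num B),
    (t.2.2.map Fin.val Fin.val).num B)

theorem encTrans_injective : (encTrans (N := N) (B := B)).Injective := by
  rintro ⟨q, o, p⟩ ⟨q', o', p'⟩ h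
  simp only [encTrans, Prod.mk.injEq] at h
  obtain ⟨hq, ho, hp⟩ := h
  obtain rfl := (stEquiv N B).injective (Fin.ext hq)
  obtain rfl := (stEquiv N B).injective (Fin.ext hp)
  have : o = o' := by
    cases o <;> cases o' <;> simp only [Op.map, Op.broadcast.injEq, Op.receive.injEq,
      reduceCtorEq] at ho ⊢ <;> exact (msgEquiv B).injective (Fin.ext ho)
  rw [this]

theorem encTrans_mem (hM : ∀ l, (M l).map Fin.val Fin.val = I l) (hh : ∀ l, M l = .halt ↔ l = h)
    {t : St (Fin N) (Fin B) × Op (Msg (Fin B)) × St (Fin N) (Fin B)}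
    (ht : t ∈ (machineProtocol M s).trans) : encTrans t ∈ machineTrans N B h s I := by
  have hl : ∀ (l : Fin N) u, u ∈ leaderTrans B l ((M l).map Fin.val Fin.val) →
      u ∈ machineTrans N B h s I := fun l u hu => by
    refine List.mem_append_right _ (List.mem_append_right _ (List.mem_flatMap.2
      ⟨l, List.mem_range.2 l.2, ?_⟩))
    rwa [← hM]
  have ho : ∀ u, u ∈ otherTrans B → u ∈ machineTrans N B h s I := fun u hu =>
    List.mem_append_right _ (List.mem_append_left _ hu)
  have hs : ∀ u, u ∈ startTrans B h s → u ∈ machineTrans N B h s I := fun u hu =>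
    List.mem_append_left _ hu
  obtain ⟨q, o | a, q'⟩ := t
  · have hb : Bcast M s q o q' := ht
    cases hb with
    | elect => exact hs _ (by simp [encTrans, startTrans, Op.map, St.map, St.num, Msg.map, Msg.num])
    | reset hi =>
      obtain rfl := (hh _).1 hi
      exact hs _ (by simp [encTrans, startTrans, Op.map, St.map, St.num, Msg.map, Msg.num])
    | push r =>
      refine ho _ (List.mem_append_right _ (List.mem_flatMap.2 ⟨r, List.mem_range.2 r.2, ?_⟩))
      simp [encTrans, Op.map, St.map, St.num, Msg.map, Msg.num]
    | pop r =>
      refine ho _ (List.mem_append_right _ (List.mem_flatMap.2 ⟨r, List.mem_range.2 r.2, ?_⟩))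
      simp [encTrans, Op.map, St.map, St.num, Msg.map, Msg.num]
    | @zero l r l' l'' hi =>
      refine hl l _ (List.mem_append_left _ ?_)
      simp [hi, Instr.map, encTrans, Op.map, St.map, St.num, Msg.map, Msg.num]
    | @done l hi =>
      refine hl l _ (List.mem_append_left _ ?_)
      simp [hi, Instr.map, encTrans, Op.map, St.map, St.num, Msg.map, Msg.num]
  · have hr : recv M q a = some q' := ht
    cases q with
    | init =>
      cases a <;> simp only [recv, reduceCtorEq, Option.some.injEq] at hr
      subst hr
      exact ho _ (by simp [encTrans, otherTrans, Op.map, St.map, St.num, Msg.map, Msg.num])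
    | pool =>
      cases a <;> simp only [recv, reduceCtorEq, Option.some.injEq] at hr
      subst hr
      exact ho _ (by simp [encTrans, otherTrans, Op.map, St.map, St.num, Msg.map, Msg.num])
    | dead => cases a <;> cases hr
    | final => cases a <;> cases hr
    | leader l =>
      cases a <;> simp only [recv, reduceCtorEq, Option.some.injEq] at hr
      all_goals
        subst hr
        rename_i r
        refine hl l _ (List.mem_append_right _ (List.mem_flatMap.2 ⟨r, List.mem_range.2 r.2, ?_⟩))
        simp [encTrans, Op.map, St.map, St.num, Msg.map, Msg.num, ← Instr.map_afterInc,
          ← Instr.map_afterDec]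
    | counter r =>
      refine ho _ (List.mem_append_right _ (List.mem_flatMap.2 ⟨r, List.mem_range.2 r.2, ?_⟩))
      cases a <;> simp only [recv, reduceCtorEq, Option.some.injEq] at hr
      · subst hr
        simp [encTrans, Op.map, St.map, St.num, Msg.map, Msg.num]
      · subst hr
        simp [encTrans, Op.map, St.map, St.num, Msg.map, Msg.num]
      · split_ifs at hr with h
        cases hr
        subst h
        simp [encTrans, Op.map, St.map, St.num, Msg.map, Msg.num]

theorem exists_encTrans_eq (hM : ∀ l, (M l).map Fin.val Fin.val = I l)
    (hh : ∀ l, M l = .halt ↔ l = h) {u : ℕ × Op ℕ × ℕ} (hu : u ∈ machineTrans N B h s I) :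
    ∃ t ∈ (machineProtocol M s).trans, encTrans t = u := by
  simp only [machineTrans, List.mem_append] at hu
  obtain hu | hu | hu := hu
  · simp only [startTrans, List.mem_cons, List.not_mem_nil, or_false] at hu
    obtain rfl | rfl := hu
    · exact ⟨(.init, .broadcast .start, .leader s), .elect, rfl⟩
    · exact ⟨(.leader h, .broadcast .reset, .leader s), .reset ((hh h).2 rfl), rfl⟩
  · simp only [otherTrans, List.mem_append, List.mem_flatMap, List.mem_range, List.mem_cons,
      List.not_mem_nil, or_false] at hu
    obtain (rfl | rfl) | ⟨r, hr, rfl | rfl | rfl | rfl | rfl⟩ := hu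
    · exact ⟨(.init, .receive .start, .pool), rfl, rfl⟩
    · exact ⟨(.pool, .receive .done, .final), rfl, rfl⟩
    · exact ⟨(.pool, .broadcast (.inc ⟨r, hr⟩), .counter ⟨r, hr⟩), .push _, rfl⟩
    · exact ⟨(.counter ⟨r, hr⟩, .broadcast (.dec ⟨r, hr⟩), .pool), .pop _, rfl⟩
    · exact ⟨(.counter ⟨r, hr⟩, .receive (.zero ⟨r, hr⟩), .dead), if_pos rfl, rfl⟩
    · exact ⟨(.counter ⟨r, hr⟩, .receive .reset, .pool), rfl, rfl⟩
    · exact ⟨(.counter ⟨r, hr⟩, .receive .done, .final), rfl, rfl⟩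
  · obtain ⟨l, hl, hu⟩ := List.mem_flatMap.1 hu
    rw [List.mem_range] at hl
    obtain ⟨l, rfl⟩ : ∃ l' : Fin N, (l' : ℕ) = l := ⟨⟨l, hl⟩, rfl⟩
    rw [← hM] at hu
    obtain hu | hu := List.mem_append.1 hu
    · cases hi : M l with
      | halt =>
        rw [hi] at hu
        obtain rfl := List.mem_singleton.1 hu
        exact ⟨(.leader l, .broadcast .done, .final), .done hi, rfl⟩
      | inc => rw [hi] at hu; cases hu
      | dec r l' l'' =>
        rw [hi] at hu
        obtain rfl := List.mem_singleton.1 hu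
        exact ⟨(.leader l, .broadcast (.zero r), .leader l'), .zero hi, rfl⟩
    · simp only [List.mem_flatMap, List.mem_range, List.mem_cons, List.not_mem_nil, or_false] at hu
      obtain ⟨r, hr, rfl | rfl⟩ := hu
      · refine ⟨(.leader l, .receive (.inc ⟨r, hr⟩), (M l).afterInc ⟨r, hr⟩), rfl, ?_⟩
        simp only [encTrans, Instr.map_afterInc]
        rfl
      · refine ⟨(.leader l, .receive (.dec ⟨r, hr⟩), (M l).afterDec ⟨r, hr⟩), rfl, ?_⟩
        simp only [encTrans, Instr.map_afterDec]
        rfl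

/-- The raw data of the protocol. -/
def machineCode (N B h s : ℕ) (I : ℕ → Instr ℕ ℕ) : RawCode :=
  ((4 + B + N, 3 + 3 * B, 0), machineTrans N B h s I)

theorem machineCode_valid (hM : ∀ l, (M l).map Fin.val Fin.val = I l)
    (hh : ∀ l, M l = .halt ↔ l = h) : (machineCode N B h s I).Valid := by
  refine ⟨by simp only [machineCode]; omega, fun u hu => ?_⟩
  obtain ⟨⟨q, o, q'⟩, -, rfl⟩ := exists_encTrans_eq hM hh hu
  refine ⟨(stEquiv N B q).2, ?_, (stEquiv N B q').2⟩
  cases o with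
  | broadcast a => exact (msgEquiv B a).2
  | receive a => exact (msgEquiv B a).2

/-- The raw data present the protocol of the machine. -/
noncomputable def machineIso (hM : ∀ l, (M l).map Fin.val Fin.val = I l)
    (hh : ∀ l, M l = .halt ↔ l = h) :
    (machineProtocol M s).Iso
      (ProtocolCode.toProtocol ⟨machineCode N B h s I, machineCode_valid hM hh⟩) where
  states := stEquiv N B
  msgs := msgEquiv B
  init_eq := rfl
  mem_iff q o q' := by
    have : encTrans (q, o, q') ∈ machineTrans N B h s I ↔
        (q, o, q') ∈ (machineProtocol M s).trans := by
      refine ⟨fun hu => ?_, encTrans_mem hM hh⟩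
      obtain ⟨t, ht, he⟩ := exists_encTrans_eq hM hh hu
      rwa [← encTrans_injective he]
    rw [← this]
    cases o <;> exact Iff.rfl

end Encoding

/-! ### The reduction -/

theorem Op.primrec_receive : Primrec (Op.receive : ℕ → Op ℕ) :=
  (Primrec.of_equiv_symm (e := Op.equivSum ℕ)).comp Primrec.sumInr

/-- The presentation is computable from the number of loading instructions. -/
theorem primrec_machineCode (F B i h : ℕ) {I : ℕ → Instr ℕ ℕ}
    (hI : ∀ j, I (F + j) = .inc 0 (if j = 0 then i else F + j - 1)) :
    Primrec fun x => machineCode (F + x + 1) B h (F + x) I := by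
  have hadd : ∀ k : ℕ, Primrec fun x : ℕ => k + x := fun k => Primrec.nat_add.comp (.const k) .id
  have hstart : Primrec fun x => startTrans B h (F + x) := by
    have h1 : Primrec fun x => 4 + B + (F + x) := (hadd _).comp (hadd _)
    exact Primrec.list_cons.comp ((Primrec.const 0).pair ((Primrec.const _).pair h1))
      (Primrec.list_cons.comp ((Primrec.const _).pair ((Primrec.const _).pair h1))
        (Primrec.const []))
  have hload : Primrec fun j => leaderTrans B (F + j) (I (F + j)) := by
    have hj : Primrec fun p : ℕ × ℕ => 4 + B + (F + p.1) :=
      (hadd _).comp ((hadd _).comp Primrec.fst)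
    have htarget : Primrec fun p : ℕ × ℕ =>
        if 0 = p.2 then 4 + B + (if p.1 = 0 then i else F + p.1 - 1) else 2 :=
      Primrec.ite (Primrec.eq.comp (.const 0) Primrec.snd)
        ((hadd _).comp (Primrec.ite (Primrec.eq.comp Primrec.fst (.const 0)) (.const i)
          (Primrec.pred.comp ((hadd F).comp Primrec.fst)))) (.const 2)
    have : Primrec₂ fun j r : ℕ => [(4 + B + (F + j), Op.receive (3 + r),
        if 0 = r then 4 + B + (if j = 0 then i else F + j - 1) else 2),
        (4 + B + (F + j), Op.receive (3 + B + r), 2)] :=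
      Primrec.list_cons.comp
        (hj.pair ((Op.primrec_receive.comp ((hadd _).comp Primrec.snd)).pair htarget))
        (Primrec.list_cons.comp
          (hj.pair ((Op.primrec_receive.comp ((hadd _).comp Primrec.snd)).pair (.const 2)))
          (Primrec.const []))
    refine (Primrec.list_flatMap (Primrec.const (List.range B)) this).of_eq fun j => ?_
    rw [hI, leaderTrans, List.nil_append]
    refine congrArg (List.flatMap · _) (funext fun r => ?_)
    by_cases hr : 0 = r <;> simp [Instr.afterInc, Instr.afterDec, hr, St.num]
  have hload' : Primrec fun x => (List.range (x + 1)).flatMap fun j =>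
      leaderTrans B (F + j) (I (F + j)) :=
    Primrec.list_flatMap (Primrec.list_range.comp Primrec.succ) (hload.comp Primrec.snd)
  have htrans : Primrec fun x => machineTrans (F + x + 1) B h (F + x) I := by
    -- Only the starting state and the loading instructions depend on `x`.
    refine (Primrec.list_append.comp hstart (Primrec.list_append.comp (Primrec.const (otherTrans B))
      (Primrec.list_append.comp (Primrec.const ((List.range F).flatMap fun l =>
        leaderTrans B l (I l))) hload'))).of_eq fun x => ?_
    rw [machineTrans, add_assoc, List.range_add (n := F), List.flatMap_append, List.flatMap_map]
  exact (((hadd _).comp (Primrec.succ.comp (hadd F))).pair (Primrec.const _)).pair htrans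

theorem not_computablePred : ¬ ComputablePred Synchro ∧ ¬ ComputablePred RepeatedCoverability := by
  obtain ⟨F, B, i, h, I, hB, hi, hh, hF, hhalt, hI, hU⟩ := exists_machine_not_computablePred
  -- The machine with finitely many control states that has the loading instructions up to `F + x`.
  have hM : ∀ x (l : Fin (F + x + 1)), ∃ i : Instr (Fin (F + x + 1)) (Fin B),
      i.map Fin.val Fin.val = I l := by
    intro x l
    have hl : (I l).Forall (· < F + x + 1) (· < B) := by
      by_cases hl : (l : ℕ) < F
      · have := hF l hl
        generalize I l = j at this
        cases j with
        | halt => trivial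
        | inc => exact ⟨this.1, by have := this.2; omega⟩
        | dec => exact ⟨this.1, by have := this.2.1; omega, by have := this.2.2; omega⟩
      · obtain ⟨j, hj⟩ := Nat.exists_eq_add_of_le (not_lt.1 hl)
        rw [hj, hI]
        refine ⟨hB, ?_⟩
        split_ifs <;> omega
    generalize I l = j at hl
    cases j with
    | halt => exact ⟨.halt, rfl⟩
    | inc r l => exact ⟨.inc ⟨r, hl.1⟩ ⟨l, hl.2⟩, rfl⟩
    | dec r l l' => exact ⟨.dec ⟨r, hl.1⟩ ⟨l, hl.2.1⟩ ⟨l', hl.2.2⟩, rfl⟩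
  choose M hM using hM
  have hh' : ∀ x (l : Fin (F + x + 1)), M x l = .halt ↔ l = ⟨h, by omega⟩ := by
    intro x l
    rw [← Fin.val_inj, ← hhalt, ← hM]
    cases M x l <;> simp [Instr.map]
  have hhalts : ∀ x, Halts I (F + x) 0 ↔ Halts (M x) (Fin.last (F + x)) 0 := fun x =>
    halts_map_iff Fin.val_injective (fun l => (hM x l).symm) (Fin.last (F + x)) 0
  have hprim := primrec_machineCode F B i h hI
  have hvalid : ∀ x, (machineCode (F + x + 1) B h (F + x) I).Valid := fun x =>
    machineCode_valid (s := Fin.last (F + x)) (hM x) (hh' x)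
  have hcode : Primrec fun x =>
      (⟨machineCode (F + x + 1) B h (F + x) I, hvalid x⟩ : ProtocolCode) :=
    Primrec.subtype_mk hprim
  have hfinal : ∀ x, 3 < ProtocolCode.numStates
      (⟨machineCode (F + x + 1) B h (F + x) I, hvalid x⟩ : ProtocolCode) := fun x => by
    simp only [ProtocolCode.numStates, machineCode]
    omega
  have hrestart : ∀ x, (4 + B + h, Op.broadcast 1, 4 + B + (F + x)) ∈ ProtocolCode.transList
      (⟨machineCode (F + x + 1) B h (F + x) I, hvalid x⟩ : ProtocolCode) := fun x =>
    List.mem_append_left _ (List.mem_cons_of_mem _ List.mem_cons_self)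
  refine ⟨fun H => hU ?_, fun H => hU ?_⟩
  · refine ComputablePred.computable_of_manyOneReducible ⟨fun x =>
      (⟨(⟨_, hvalid x⟩, 3), hfinal x⟩ : SynchroInput),
      (Primrec.subtype_val_iff.1 (hcode.pair (.const 3))).to_comp, fun x => ?_⟩ H
    exact (hhalts x).trans (synchronizes_iff.symm.trans
      (machineIso (s := Fin.last (F + x)) (hM x) (hh' x)).synchronizes_iff.symm)
  · have hstate : Primrec fun x => 4 + B + (F + x) :=
      Primrec.nat_add.comp (.const _) (Primrec.nat_add.comp (.const F) .id)
    refine ComputablePred.computable_of_manyOneReducible ⟨fun x =>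
      (⟨(⟨_, hvalid x⟩, (4 + B + h, 1, 4 + B + (F + x))), hrestart x⟩ : RepeatedCoverabilityInput),
      (Primrec.subtype_val_iff.1 (hcode.pair ((Primrec.const _).pair ((Primrec.const 1).pair
        hstate)))).to_comp, fun x => ?_⟩ H
    exact (hhalts x).trans ((repeatedlyCovers_iff (hh' x)).symm.trans
      (machineIso (s := Fin.last (F + x)) (hM x) (hh' x)).repeatedlyCovers_iff.symm)

end BroadcastNetwork

theorem mainTheorem6 :
    ¬ ComputablePred BroadcastNetwork.Synchro ∧
      ¬ ComputablePred BroadcastNetwork.RepeatedCoverability :=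
  BroadcastNetwork.not_computablePred
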